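/- **Setting.** A signature $\Sigma$ is a finite set of symbols with finite arities. Terms are finite or infinite first-order terms over $\Sigma$ and a countably infinite set of variables. A rule $\ell\to r$ has a finite non-variable left-hand side $\ell$ and a finite or infinite right-hand side $r$ with $\mathrm{Var}(r)\subseteq\mathrm{Var}(\ell)$. An iTRS $\mathcal R$ consists of finitely many rules (it is a TRS if all right-hand sides are finite). It is *weakly orthogonal* if it is left-linear (no variable occurs twice in a left-hand side) and all its critical pairs are trivial (have equal components), and has no *collapsing rules* if no right-hand side is a variable. A *redex* in a term $t$ is a pair $\langle p,\rho\rangle$ of a position $p$ of $t$ and a rule $\rho:\ell\to r$ such that $t|_p$ is an instance of $\ell$; its *pattern* is the set of positions $pq$ such that $\ell(q)$ is a function symbol. Two redexes *overlap* if their patterns intersect. A *multi-redex* in $t$ is a set $U$ of pairwise non-overlapping redexes in $t$. Let $t^U$ be $t$ with, for each $\langle p,\rho\rangle\in U$, the symbol at $p$ labelled by $\rho$. We write $t\Rightarrow_U t'$ (multi-step, complete development of $U$) if there is a strongly convergent transfinite rewrite sequence from $t^U$ to the unlabelled term $t'$ with respect to the rules $\ell^\rho\to r$, for the rules $\rho:\ell\to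 r$ of $\mathcal R$, where $\ell^\rho$ is $\ell$ with its root symbol labelled by $\rho$. We write $t\Rightarrow t'$ if $t\Rightarrow_U t'$ for some multi-redex $U$ in $t$. A relation $\to$ on $A$ has the *triangle property*, witnessed by a function $\bullet:A\to A$, if $a\to a^\bullet$ for all $a\in A$, and $a\to b$ implies $b\to a^\bullet$ for all $a,b\in A$. A *cluster* in $t$ is a connected component of the set of redexes in $t$ with respect to overlap. It is a *Y-cluster* if it contains two redexes at parallel positions, and an *I-cluster* otherwise; it is *infinite* if its redexes have infinitely many root positions. It is *trivial* if it is a Y-cluster or an infinite I-cluster. The *root-path* of an I-cluster consists of the positions lying (weakly) between the roots of two of its redexes, and the *tail* of one of its redexes is the maximal position of its pattern on the root-path. A *full multi-redex* of a cluster is $\varnothing$ if the cluster is trivial. Otherwise it is any set obtained by repeating the following until no selection is possible: among the redexes of the cluster that are below (have their root below the root of, and do not overlap) all already selected ones, select one with topmost tail. A *full multi-redex* of $t$ is a union of full multi-redexes, one for each cluster in $t$. **Theorem (Triangle).** Let $\mathcal R$ be a weakly orthogonal iTRS (in particular, a weakly orthogonal TRS) without collapsing rules. Then the multi-step relation $\Rightarrow$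 on finite and infinite terms has the triangle property. Moreover, every term $t$ has a full multi-redex $F$; for every full multi-redex $F$ of a term $t$ (which is a multi-redex in $t$) there is a term $s$ with $t\Rightarrow_F s$; and every function $\bullet$ that maps each term $t$ to a term $t^\bullet$ with $t\Rightarrow_F t^\bullet$ for some full multi-redex $F$ of $t$ witnesses the triangle property of $\Rightarrow$. -/

import Mathlib

/-! # Infinitary term rewriting: terms, rules, transfinite reductions, multi-steps, clusters -/

universe u

/-- A (finite, first-order) signature: finitely many symbols, each with an arity. -/
structure Signature where
  Sym : Type u
  finite : Finite Sym
  arity : Sym → ℕ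

/-- A finite or infinite term over `S`, with variables taken from the fixed countably infinite set
`ℕ`: a partial map from positions (finite words over `ℕ`) to symbols and variables that is defined
at the root, and is defined at `p · i` iff `p` carries a function symbol of arity `> i`.
The arguments of a symbol of arity `n` are numbered `0, …, n - 1`. -/
@[ext]
structure Term (S : Signature.{u}) where
  fn : List ℕ → Option (S.Sym ⊕ ℕ)
  root_isSome : (fn []).isSome
  child_isSome : ∀ (p : List ℕ) (i : ℕ),
    (fn (p ++ [i])).isSome ↔ ∃ f : S.Sym, fn p = some (Sum.inl f) ∧ i < S.arity f

namespace Term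

variable {S : Signature.{u}}

/-- The set of positions of a term. -/
def positions (t : Term S) : Set (List ℕ) := {p | (t.fn p).isSome}

/-- The set of positions of a term that carry a function symbol. -/
def funPositions (t : Term S) : Set (List ℕ) := {p | ∃ f : S.Sym, t.fn p = some (Sum.inl f)}

/-- A term is finite if it has finitely many positions. -/
def IsFinite (t : Term S) : Prop := t.positions.Finite

/-- The set of variables that occur in a term. -/
def vars (t : Term S) : Set ℕ := {x | ∃ p, t.fn p = some (Sum.inr x)}

/-- The variables of `t` that occur outside of the subterm at position `p`,
i.e. the variables of the context obtained from `t` by putting a hole at `p`. -/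
def varsOutside (t : Term S) (p : List ℕ) : Set ℕ :=
  {x | ∃ q, ¬ p <+: q ∧ t.fn q = some (Sum.inr x)}

/-- The term is a variable. -/
def IsVar (t : Term S) : Prop := ∃ x : ℕ, t.fn [] = some (Sum.inr x)

/-- No variable occurs at two different positions. -/
def IsLinear (t : Term S) : Prop :=
  ∀ (p q : List ℕ) (x : ℕ), t.fn p = some (Sum.inr x) → t.fn q = some (Sum.inr x) → p = q

/-- The subterm of `t` at a position `p` of `t`. -/
def subterm (t : Term S) (p : List ℕ) (hp : p ∈ t.positions) : Term S where
  fn q := t.fn (p ++ q)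
  root_isSome := by simpa [positions] using hp
  child_isSome q i := by rw [← List.append_assoc]; exact t.child_isSome (p ++ q) i

open Classical in
/-- The term `t[u]_p`, obtained from `t` by replacing the subterm at the position `p` by `u`. -/
noncomputable def replace (t : Term S) (p : List ℕ) (hp : p ∈ t.positions) (u : Term S) :
    Term S where
  fn q := if p <+: q then u.fn (q.drop p.length) else t.fn q
  root_isSome := by
    by_cases h : p <+: []
    · simpa [h] using u.root_isSome
    · simpa [h] using t.root_isSome
  child_isSome q i := by
    by_cases h : p <+: q
    · have h' : p <+: q ++ [i] := h.trans (List.prefix_append _ _)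
      rw [if_pos h', if_pos h, List.drop_append_of_le_length h.length_le]
      exact u.child_isSome _ i
    · by_cases h' : p <+: q ++ [i]
      · have he : p = q ++ [i] := by
          rcases List.prefix_concat_iff.1 (by simpa using h') with h1 | h1
          · simpa using h1
          · exact absurd h1 h
        rw [if_pos h', if_neg h, ← t.child_isSome, ← he]
        simp only [List.drop_length]
        exact ⟨fun _ => hp, fun _ => u.root_isSome⟩
      · rw [if_neg h', if_neg h]
        exact t.child_isSome q i

/-- The position function of an instance of a term, by recursion on the position: walk down, and
continue in `σ x` as soon as a variable `x` is met. -/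
def substFn (σ : ℕ → Term S) :
    (List ℕ → Option (S.Sym ⊕ ℕ)) → List ℕ → Option (S.Sym ⊕ ℕ)
  | t, [] =>
    match t [] with
    | some (Sum.inr x) => (σ x).fn []
    | o => o
  | t, i :: p =>
    match t [] with
    | some (Sum.inr x) => (σ x).fn (i :: p)
    | _ => substFn σ (fun q => t (i :: q)) p

theorem substFn_child (σ : ℕ → Term S) (p : List ℕ) (i : ℕ) :
    ∀ t : List ℕ → Option (S.Sym ⊕ ℕ),
      (∀ q j, (t (q ++ [j])).isSome ↔ ∃ f : S.Sym, t q = some (Sum.inl f) ∧ j < S.arity f) →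
      ((substFn σ t (p ++ [i])).isSome ↔
        ∃ f : S.Sym, substFn σ t p = some (Sum.inl f) ∧ i < S.arity f) := by
  induction p with
  | nil =>
    intro t ht
    have h0 := ht [] i
    rcases h : t [] with _ | (f | x)
    · rcases h2 : t [i] with _ | (g | y) <;> simp_all [substFn]
    · rcases h2 : t [i] with _ | (g | y) <;> simp_all [substFn, (σ _).root_isSome]
    · simpa [substFn, h] using (σ x).child_isSome [] i
  | cons j p ih =>
    intro t ht
    have ih' := ih (fun q => t (j :: q)) (fun q k => by simpa using ht (j :: q) k)
    rcases h : t [] with _ | (f | x)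
    · simpa [substFn, h] using ih'
    · simpa [substFn, h] using ih'
    · simpa [substFn, h] using (σ x).child_isSome (j :: p) i

/-- The instance `σ t` of the term `t` under the substitution `σ`. -/
def subst (σ : ℕ → Term S) (t : Term S) : Term S where
  fn := substFn σ t.fn
  root_isSome := by
    have h0 := t.root_isSome
    rcases h : t.fn [] with _ | (f | x)
    · simp [h] at h0
    · simp [substFn, h]
    · simpa [substFn, h] using (σ x).root_isSome
  child_isSome p i := substFn_child σ p i t.fn t.child_isSome

/-- Below a variable `x` of `t`, the instance continues as `σ x`. -/
theorem subst_fn_of_var (σ : ℕ → Term S) (t : Term S) {p : List ℕ} {x : ℕ}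
    (hp : t.fn p = some (Sum.inr x)) (q : List ℕ) :
    (t.subst σ).fn (p ++ q) = (σ x).fn q := by
  have key : ∀ (p : List ℕ) (t : List ℕ → Option (S.Sym ⊕ ℕ)),
      (∀ q j, (t (q ++ [j])).isSome ↔ ∃ f : S.Sym, t q = some (Sum.inl f) ∧ j < S.arity f) →
      t p = some (Sum.inr x) → substFn σ t (p ++ q) = (σ x).fn q := by
    intro p
    induction p with
    | nil => intro t _ h; cases q <;> simp [substFn, h]
    | cons j p ih =>
      intro t ht h
      have hroot : ∀ (p : List ℕ), (t p).isSome → ∀ y, t [] = some (Sum.inr y) → p = [] := by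
        intro p
        induction p using List.reverseRecOn with
        | nil => intros; rfl
        | append_singleton p k ihp =>
          intro h1 y hy
          obtain ⟨f, hf, _⟩ := (ht p k).1 h1
          have := ihp (by simp [hf]) y hy
          subst this
          simp [hf] at hy
      have ih' := ih (fun q => t (j :: q)) (fun q k => by simpa using ht (j :: q) k) h
      rcases h2 : t [] with _ | (f | y)
      · simpa [substFn, h2] using ih'
      · simpa [substFn, h2] using ih'
      · exact absurd (hroot (j :: p) (by simp [h]) y h2) (by simp)
  exact key p t.fn t.child_isSome hp

/-- At positions that are not at or below a variable of `t`, the instance agrees with `t`. -/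
theorem subst_fn_of_not (σ : ℕ → Term S) (t : Term S) (p : List ℕ)
    (hp : ∀ q x, q <+: p → t.fn q ≠ some (Sum.inr x)) :
    (t.subst σ).fn p = t.fn p := by
  have key : ∀ (p : List ℕ) (t : List ℕ → Option (S.Sym ⊕ ℕ)),
      (∀ q x, q <+: p → t q ≠ some (Sum.inr x)) → substFn σ t p = t p := by
    intro p
    induction p with
    | nil =>
      intro t h
      have h0 := h []
      rcases h2 : t [] with _ | (f | y) <;> simp_all [substFn]
    | cons j p ih =>
      intro t h
      have ih' := ih (fun q => t (j :: q))
        (fun q x hq => h (j :: q) x (List.prefix_cons_inj j |>.2 hq))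
      have h0 := fun x => h [] x (List.nil_prefix)
      rcases h2 : t [] with _ | (f | y)
      · simpa [substFn, h2] using ih'
      · simpa [substFn, h2] using ih'
      · exact absurd h2 (h0 y)
  exact key p t.fn hp

open Classical in
/-- The metric on terms: `0` for equal terms, and otherwise `2 ^ (-k)` where `k` is the least
length of a position at which the terms differ. -/
noncomputable def distance (s t : Term S) : ℝ :=
  if s = t then 0
  else (2 : ℝ)⁻¹ ^ sInf {k : ℕ | ∃ p : List ℕ, p.length = k ∧ s.fn p ≠ t.fn p}

end Term

/-- An (infinitary) rewrite rule: the left-hand side is a finite term that is not a variable, the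
right-hand side is a finite or infinite term all of whose variables occur in the left-hand side. -/
@[ext]
structure Rule (S : Signature.{u}) where
  lhs : Term S
  rhs : Term S
  lhs_finite : lhs.IsFinite
  lhs_not_var : ¬ lhs.IsVar
  vars_subset : rhs.vars ⊆ lhs.vars

/-- A most general common instance: `σ a = τ b`, and every common instance of `a` and `b` is an
instance of it. -/
def IsMostGeneralCommonInstance {S : Signature.{u}} (a b : Term S) (σ τ : ℕ → Term S) : Prop :=
  a.subst σ = b.subst τ ∧
  ∀ σ' τ' : ℕ → Term S, a.subst σ' = b.subst τ' →
    ∃ υ : ℕ → Term S, (a.subst σ).subst υ = a.subst σ'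

/-- `(t, s)` is a critical pair of `ρ₁` with inner rule `ρ₂`: there are a function symbol position
`p` of `ℓ₁` and `σ`, `τ` such that `σ (ℓ₁|_p) = τ ℓ₂` is a most general common instance of
`ℓ₁|_p` and `ℓ₂`, where `σ` moves only variables of `ℓ₁|_p` and the variables of the common
instance are fresh for the context `ℓ₁[□]_p`, and
`t = (σ ℓ₁)[τ r₂]_p`, `s = σ r₁`. -/
def IsCriticalPair {S : Signature.{u}} (ρ₁ ρ₂ : Rule S) (t s : Term S) : Prop :=
  ∃ (p : List ℕ) (hp : p ∈ ρ₁.lhs.positions) (σ τ : ℕ → Term S)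
    (hp' : p ∈ (ρ₁.lhs.subst σ).positions),
    p ∈ ρ₁.lhs.funPositions ∧
    IsMostGeneralCommonInstance (ρ₁.lhs.subterm p hp) ρ₂.lhs σ τ ∧
    (∀ x : ℕ, x ∉ (ρ₁.lhs.subterm p hp).vars → (σ x).fn [] = some (Sum.inr x)) ∧
    Disjoint ((ρ₁.lhs.subterm p hp).subst σ).vars (ρ₁.lhs.varsOutside p) ∧
    t = (ρ₁.lhs.subst σ).replace p hp' (ρ₂.rhs.subst τ) ∧
    s = ρ₁.rhs.subst σ

/-- An infinitary term rewriting system (iTRS) over `S`, with finitely many rules. -/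
structure ITRS (S : Signature.{u}) where
  rules : Set (Rule S)
  finite : rules.Finite

/-- A reduction relation has the triangle property with witness `bullet`. -/
def IsTriangleWitness {A : Type*} (r : A → A → Prop) (bullet : A → A) : Prop :=
  (∀ a, r a (bullet a)) ∧ ∀ a b, r a b → r b (bullet a)

/-- The triangle property of a relation. -/
def TriangleProperty {A : Type*} (r : A → A → Prop) : Prop :=
  ∃ bullet : A → A, IsTriangleWitness r bullet

namespace ITRS

variable {S : Signature.{u}}

/-- No rule has a left-hand side in which a variable occurs twice. -/
def LeftLinear (R : ITRS S) : Prop := ∀ ρ ∈ R.rules, ρ.lhs.IsLinear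

/-- Left-linear, and all critical pairs are trivial. -/
def WeaklyOrthogonal (R : ITRS S) : Prop :=
  R.LeftLinear ∧
  ∀ ρ₁ ∈ R.rules, ∀ ρ₂ ∈ R.rules, ∀ t s : Term S, IsCriticalPair ρ₁ ρ₂ t s → t = s

/-- No rule is collapsing, i.e. no right-hand side is a variable. -/
def NonCollapsing (R : ITRS S) : Prop := ∀ ρ ∈ R.rules, ¬ ρ.rhs.IsVar

/-- The rewrite step `s → t` at position `p`. -/
def StepAt (R : ITRS S) (p : List ℕ) (s t : Term S) : Prop :=
  ∃ (hp : p ∈ s.positions), ∃ ρ ∈ R.rules, ∃ σ : ℕ → Term S,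
    s.subterm p hp = ρ.lhs.subst σ ∧ t = s.replace p hp (ρ.rhs.subst σ)

/-- There is a strongly convergent transfinite rewrite sequence from `s` to `t`:
terms `a β` for `β ≤ α` with steps `a β → a (β + 1)` at position `p β` for `β < α` such that at
every limit ordinal `l ≤ α` the terms converge to `a l` and the depth of the steps tends to
infinity; `s` is the first term, `t = a α` the last term or the limit. -/
def InfRed (R : ITRS S) (s t : Term S) : Prop :=
  ∃ (α : Ordinal.{0}) (a : Ordinal.{0} → Term S) (p : Ordinal.{0} → List ℕ),
    a 0 = s ∧ a α = t ∧
    (∀ β < α, R.StepAt (p β) (a β) (a (Order.succ β))) ∧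
    ∀ l ≤ α, Order.IsSuccLimit l →
      (∀ ε : ℝ, 0 < ε → ∃ γ < l, ∀ β, γ ≤ β → β < l → (a β).distance (a l) < ε) ∧
      (∀ n : ℕ, ∃ γ < l, ∀ β, γ ≤ β → β < l → n ≤ (p β).length)

/-! ## Redexes and multi-redexes -/

/-- A position together with a rule. -/
@[ext]
structure Redex (R : ITRS S) where
  pos : List ℕ
  rule : R.rules

/-- The redexes in `t`: the subterm at the position is an instance of the left-hand side. -/
def redexes (R : ITRS S) (t : Term S) : Set R.Redex :=
  {u | ∃ (hp : u.pos ∈ t.positions) (σ : ℕ → Term S),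
    t.subterm u.pos hp = u.rule.1.lhs.subst σ}

/-- The pattern of a redex: the positions of the function symbols of its left-hand side. -/
def Redex.pattern {R : ITRS S} (u : R.Redex) : Set (List ℕ) :=
  {p | ∃ q ∈ u.rule.1.lhs.funPositions, p = u.pos ++ q}

/-- Two redexes overlap if their patterns intersect. -/
def Redex.Overlap {R : ITRS S} (u v : R.Redex) : Prop := (u.pattern ∩ v.pattern).Nonempty

/-- A multi-redex in `t`: a set of pairwise non-overlapping redexes in `t`. -/
def IsMultiRedex (R : ITRS S) (t : Term S) (U : Set R.Redex) : Prop :=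
  U ⊆ R.redexes t ∧ ∀ u ∈ U, ∀ v ∈ U, u ≠ v → ¬ u.Overlap v

/-! ## Developments by labelling -/

/-- The labelled signature: all symbols `f` of `S`, and all labelled symbols `f ^ ρ` with `ρ` a rule
of `R`, of the same arity. -/
def labelledSig (R : ITRS S) : Signature.{u} where
  Sym := S.Sym ⊕ (S.Sym × R.rules)
  finite := by
    have := S.finite
    have : Finite R.rules := R.finite
    infer_instance
  arity := Sum.elim S.arity (fun a => S.arity a.1)

/-- The (labelled) symbol `f` or `f ^ ρ`; variables carry no labels. -/
def labelSym (R : ITRS S) : Option R.rules → S.Sym ⊕ ℕ → R.labelledSig.Sym ⊕ ℕ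
  | none, Sum.inl f => Sum.inl (Sum.inl f)
  | some ρ, Sum.inl f => Sum.inl (Sum.inr (f, ρ))
  | _, Sum.inr x => Sum.inr x

/-- The labelled term obtained from `t` by labelling, for all `p` with `lab p = some ρ`, the
function symbol at `p` (if there is one) with `ρ`. -/
def labelWith (R : ITRS S) (lab : List ℕ → Option R.rules) (t : Term S) :
    Term R.labelledSig where
  fn p := (t.fn p).map (R.labelSym (lab p))
  root_isSome := by simpa using t.root_isSome
  child_isSome p i := by
    simp only [Option.isSome_map]
    rw [t.child_isSome]
    constructor
    · rintro ⟨f, hf, hi⟩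
      rcases h : lab p with _ | ρ
      · exact ⟨Sum.inl f, by simp [hf, labelSym], by simpa [labelledSig] using hi⟩
      · exact ⟨Sum.inr (f, ρ), by simp [hf, labelSym], by simpa [labelledSig] using hi⟩
    · rintro ⟨g, hg, hi⟩
      rcases h : t.fn p with _ | (f | x)
      · simp [h] at hg
      · refine ⟨f, rfl, ?_⟩
        rcases h2 : lab p with _ | ρ <;> simp only [h, h2, labelSym, Option.map_some] at hg <;>
          obtain rfl := Sum.inl.inj (Option.some.inj hg) <;>
          simpa [labelledSig] using hi
      · rcases h2 : lab p with _ | ρ <;> simp [h, h2, labelSym] at hg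

theorem labelWith_fn_eq_var (R : ITRS S) (lab : List ℕ → Option R.rules) (t : Term S)
    (p : List ℕ) (x : ℕ) :
    (R.labelWith lab t).fn p = some (Sum.inr x) ↔ t.fn p = some (Sum.inr x) := by
  rcases h : t.fn p with _ | (f | y) <;> rcases h2 : lab p with _ | ρ <;>
    simp [labelWith, h, h2, labelSym]

/-- A term over `S`, seen as a labelled term without labels. -/
def unlabelled (R : ITRS S) (t : Term S) : Term R.labelledSig := R.labelWith (fun _ => none) t

open Classical in
/-- The rule `ℓ ^ ρ → r`: the root symbol of the left-hand side is labelled with `ρ`. -/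
noncomputable def labelledRule (R : ITRS S) (ρ : R.rules) : Rule R.labelledSig where
  lhs := R.labelWith (fun p => if p = [] then some ρ else none) ρ.1.lhs
  rhs := R.unlabelled ρ.1.rhs
  lhs_finite := by
    have h := ρ.1.lhs_finite
    simpa [Term.IsFinite, Term.positions, labelWith] using h
  lhs_not_var := by
    rintro ⟨x, hx⟩
    exact ρ.1.lhs_not_var ⟨x, (R.labelWith_fn_eq_var _ _ _ _).1 hx⟩
  vars_subset := by
    rintro x ⟨p, hp⟩
    obtain ⟨q, hq⟩ := ρ.1.vars_subset ⟨p, (R.labelWith_fn_eq_var _ _ _ _).1 hp⟩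
    exact ⟨q, (R.labelWith_fn_eq_var _ _ _ _).2 hq⟩

/-- The labelled iTRS: the rules `ℓ ^ ρ → r` for the rules `ρ : ℓ → r` of `R`. -/
noncomputable def labelled (R : ITRS S) : ITRS R.labelledSig where
  rules := Set.range R.labelledRule
  finite := by
    have : Finite R.rules := R.finite
    exact Set.finite_range _

open Classical in
/-- The labelled term `t ^ U`: for every redex `(p, ρ)` in `U` the symbol at `p` is labelled with
`ρ`. (In a multi-redex there is at most one `ρ` for each `p`.) -/
noncomputable def labelRedexes (R : ITRS S) (t : Term S) (U : Set R.Redex) :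
    Term R.labelledSig :=
  R.labelWith
    (fun p => if h : ∃ ρ : R.rules, (⟨p, ρ⟩ : R.Redex) ∈ U then some h.choose else none) t

/-- The multi-step from `t` to `t'` with respect to the multi-redex `U` in `t`:
a complete development of `U`. -/
def MultiStepOf (R : ITRS S) (U : Set R.Redex) (t t' : Term S) : Prop :=
  R.IsMultiRedex t U ∧ R.labelled.InfRed (R.labelRedexes t U) (R.unlabelled t')

/-- The multi-step rewrite relation. -/
def MultiStep (R : ITRS S) (t t' : Term S) : Prop := ∃ U : Set R.Redex, R.MultiStepOf U t t'

/-! ## Clusters and full multi-redexes -/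

/-- A cluster in `t`: a connected component of the redexes in `t` with respect to overlap. -/
def IsCluster (R : ITRS S) (t : Term S) (c : Set R.Redex) : Prop :=
  ∃ u ∈ R.redexes t, c = {v | Relation.ReflTransGen
    (fun a b => a ∈ R.redexes t ∧ b ∈ R.redexes t ∧ a.Overlap b) u v}

/-- The set of root positions of the redexes in `c` is infinite. -/
def InfiniteCluster {R : ITRS S} (c : Set R.Redex) : Prop := (Redex.pos '' c).Infinite

/-- A `Y`-cluster contains a pair of redexes at parallel positions. -/
def YCluster {R : ITRS S} (c : Set R.Redex) : Prop :=
  ∃ u ∈ c, ∃ v ∈ c, ¬ u.pos <+: v.pos ∧ ¬ v.pos <+: u.pos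

/-- An `I`-cluster is a cluster that is not a `Y`-cluster. -/
def ICluster {R : ITRS S} (c : Set R.Redex) : Prop := ¬ YCluster c

/-- A trivial cluster is a `Y`-cluster or an infinite `I`-cluster. -/
def TrivialCluster {R : ITRS S} (c : Set R.Redex) : Prop :=
  YCluster c ∨ (ICluster c ∧ InfiniteCluster c)

/-- The root-path of an `I`-cluster: the path through the roots of all its redexes. -/
def rootPath {R : ITRS S} (c : Set R.Redex) : Set (List ℕ) :=
  {p | ∃ u ∈ c, ∃ v ∈ c, u.pos <+: p ∧ p <+: v.pos}

/-- `p` is the tail of the redex `u` of the `I`-cluster `c`: the maximal position of (the pattern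
of) `u` on the root-path of `c`. -/
def IsTail {R : ITRS S} (c : Set R.Redex) (u : R.Redex) (p : List ℕ) : Prop :=
  p ∈ u.pattern ∩ rootPath c ∧ ∀ q ∈ u.pattern ∩ rootPath c, q <+: p

/-- `v` is below `u`: its root is below that of `u`, and `u` and `v` do not overlap. -/
def Redex.Below {R : ITRS S} (u v : R.Redex) : Prop := u.pos <+: v.pos ∧ ¬ u.Overlap v

/-- The redexes of `c` that are below all redexes in the list `l` of already selected ones. -/
def selectable {R : ITRS S} (c : Set R.Redex) (l : List R.Redex) : Set R.Redex :=
  {u | u ∈ c ∧ ∀ v ∈ l, v.Below u}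

/-- The lists of redexes of `c` that can be selected (the latest one first) by repeatedly selecting
a redex below the already selected ones whose tail is minimal, i.e. topmost, among these. -/
inductive Selection {R : ITRS S} (c : Set R.Redex) : List R.Redex → Prop
  | nil : Selection c []
  | select (l : List R.Redex) (u : R.Redex) (p : List ℕ) :
      Selection c l → u ∈ selectable c l → IsTail c u p →
      (∀ v ∈ selectable c l, ∀ q, IsTail c v q → p <+: q) →
      Selection c (u :: l)

/-- `F` is a full multi-redex of the cluster `c`: it is empty if `c` is trivial; otherwise it
consists of the redexes selected by the above procedure, run until no selection is possible. -/
def IsFullOfCluster {R : ITRS S} (c F : Set R.Redex) : Prop :=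
  (TrivialCluster c ∧ F = ∅) ∨
  (¬ TrivialCluster c ∧ ∃ l : List R.Redex,
    Selection c l ∧ selectable c l = ∅ ∧ F = {u | u ∈ l})

/-- `F` is a full multi-redex of the term `t`: a union of full multi-redexes of its clusters. -/
def IsFull (R : ITRS S) (t : Term S) (F : Set R.Redex) : Prop :=
  ∃ full : Set R.Redex → Set R.Redex,
    (∀ c, R.IsCluster t c → IsFullOfCluster c (full c)) ∧
    F = {u | ∃ c, R.IsCluster t c ∧ u ∈ full c}

/-- `bullet` maps every term `t` to a term obtained by developing a full multi-redex of `t`. -/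
def IsFullDevelopment (R : ITRS S) (bullet : Term S → Term S) : Prop :=
  ∀ t, ∃ F, R.IsFull t F ∧ R.MultiStepOf F t (bullet t)

end ITRS

/-!
# The triangle property of multi-steps in weakly orthogonal rewriting without collapsing rules

**Developments as a function.** Since no right-hand side is a variable, contracting a labelled root
produces an unlabelled symbol at the root. Hence the development of a labelled term `s` can be
written down directly: contract the root if it is labelled, read off the root symbol, and continue
with the arguments. This defines `ITRS.dev s`. It is uniformly continuous (`exists_agree_dev`) and
invariant under contraction of labels (`dev_step`), so every complete development of `t ^ U` ends
in `dev (t ^ U)`; conversely, contracting always a label of minimal depth yields a strongly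
convergent reduction to it, of length at most `ω` (`infRed_dev`). So `t ⇒_U t'` holds iff `U` is a
multi-redex in `t` and `dev (t ^ U) = t'` (`multiStepOf_iff`).

**Residuals.** For `V ⊆ U`, the development of `U` factors through the development of `V`
(`exists_residual`). To trace the labels of `U \ V` through the development of `V`, the term is
labelled twice: `t ^ (U \ V)` is a term over the labelled signature, the rules can be read as rules
on such terms (`ITRS.lift`), and all results on `dev` apply to that rewrite system.

It remains to show that for a full multi-redex `F` and an arbitrary multi-redex `U` of `t` there is
some `V ⊆ F` with `dev (t ^ U) = dev (t ^ V)` (`IsFull.exists_subset_dev_eq`). Weak orthogonality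
enters through the fact that overlapping redexes have the same contractum, also in the presence of
labels outside of the two patterns (`WeaklyOrthogonal.contract_eq`). By induction over finite
sets of redexes, and continuity for infinite ones, it follows:

* Redexes in trivial clusters can be dropped from `U`, the lowest ones first. All redexes of a
  cluster have the same contractum, which differs from `t` only below all of their roots; for a
  trivial cluster no position is below all roots, so contraction has no effect
  (`dev_insert_of_trivialCluster`).
* In any other cluster, each `u ∈ U` overlaps a redex of `F`: `u` remains selectable until the
  first redex that overlaps it is selected. The tail of this redex `φ u` is not below the tail of
  `u`, so `φ u` does not overlap redexes below `u` that do not overlap `u`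
  (`IsFullOfCluster.exists_exchange`). Therefore the redexes `u` can be exchanged for the redexes
  `φ u` one at a time from top to bottom, each time staying within multi-redexes
  (`IsExchange.dev_eq`). Note that only overlapping redexes are exchanged: two redexes of one
  cluster cannot be exchanged freely in the presence of a third one.
-/

/-! ### Positions, subterms and substitution -/

namespace Term

variable {S S' : Signature.{u}}

theorem isSome_of_append (t : Term S) {p q : List ℕ} (h : (t.fn (p ++ q)).isSome) :
    (t.fn p).isSome := by
  induction q using List.reverseRecOn with
  | nil => simpa using h
  | append_singleton q i ih =>
    rw [← List.append_assoc, t.child_isSome] at h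
    obtain ⟨f, hf, _⟩ := h
    exact ih (by simp [hf])

theorem exists_fun_of_append (t : Term S) {p q : List ℕ} (h : (t.fn (p ++ q)).isSome)
    (hq : q ≠ []) : ∃ f, t.fn p = some (Sum.inl f) := by
  obtain ⟨i, q, rfl⟩ := List.exists_cons_of_ne_nil hq
  have h' : (t.fn ((p ++ [i]) ++ q)).isSome := by simpa using h
  obtain ⟨f, hf, _⟩ := (t.child_isSome p i).1 (t.isSome_of_append h')
  exact ⟨f, hf⟩

theorem eq_nil_of_var (t : Term S) {p q : List ℕ} {x : ℕ} (hp : t.fn p = some (Sum.inr x))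
    (h : (t.fn (p ++ q)).isSome) : q = [] := by
  by_contra hq
  obtain ⟨f, hf⟩ := t.exists_fun_of_append h hq
  simp [hp] at hf

theorem mem_positions_of_fn (t : Term S) {p : List ℕ} {a : S.Sym ⊕ ℕ} (h : t.fn p = some a) :
    p ∈ t.positions := by
  simp [positions, h]

theorem nil_mem_positions (t : Term S) : [] ∈ t.positions := t.root_isSome

theorem fn_eq_none (t : Term S) {p : List ℕ} (h : p ∉ t.positions) : t.fn p = none := by
  simpa [positions] using h

theorem child_mem_positions (t : Term S) {p : List ℕ} {i : ℕ} {f : S.Sym}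
    (h : t.fn p = some (Sum.inl f)) : p ++ [i] ∈ t.positions ↔ i < S.arity f := by
  simp only [positions, Set.mem_ofPred_eq, t.child_isSome]
  constructor
  · rintro ⟨g, hg, hi⟩
    rw [h] at hg
    obtain rfl := Sum.inl.inj (Option.some.inj hg)
    exact hi
  · exact fun hi => ⟨f, h, hi⟩

theorem fun_of_prefix (t : Term S) {p q : List ℕ} {f : S.Sym} (h : t.fn q = some (Sum.inl f))
    (hpq : p <+: q) : ∃ g, t.fn p = some (Sum.inl g) := by
  obtain ⟨r, rfl⟩ := hpq
  by_cases hr : r = []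
  · subst hr; exact ⟨f, by simpa using h⟩
  · exact t.exists_fun_of_append (by simp [h]) hr

open Classical in
/-- The subterm of `t` at `p`, as a total function: it is `t` itself if `p` is no position of
`t`. -/
noncomputable def sub (t : Term S) (p : List ℕ) : Term S :=
  if h : p ∈ t.positions then t.subterm p h else t

theorem sub_eq_subterm (t : Term S) {p : List ℕ} (h : p ∈ t.positions) :
    t.sub p = t.subterm p h := by simp [sub, h]

theorem sub_fn (t : Term S) {p : List ℕ} (h : p ∈ t.positions) (q : List ℕ) :
    (t.sub p).fn q = t.fn (p ++ q) := by simp [sub, h, subterm]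

theorem sub_nil (t : Term S) : t.sub [] = t := by
  ext q : 2
  simp [t.sub_fn t.nil_mem_positions]

theorem sub_sub (t : Term S) {p q : List ℕ} (h : p ++ q ∈ t.positions) :
    (t.sub p).sub q = t.sub (p ++ q) := by
  have hp : p ∈ t.positions := t.isSome_of_append h
  ext r : 2
  rw [sub_fn, sub_fn _ hp, sub_fn _ h, List.append_assoc]
  simpa [positions, sub_fn _ hp] using h

/-- The term that consists of the variable `x`. -/
def ofVar (x : ℕ) : Term S where
  fn p := if p = [] then some (Sum.inr x) else none
  root_isSome := by simp
  child_isSome p i := by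
    by_cases h : p = [] <;> simp [h]

/-- Renaming the function symbols of a term along an arity preserving map. -/
def map (φ : S.Sym → S'.Sym) (hφ : ∀ f, S'.arity (φ f) = S.arity f) (t : Term S) : Term S' where
  fn p := (t.fn p).map (Sum.map φ id)
  root_isSome := by simpa using t.root_isSome
  child_isSome p i := by
    rw [Option.isSome_map, t.child_isSome]
    rcases h : t.fn p with _ | (f | x) <;> simp [hφ]

theorem map_fn_fun {φ : S.Sym → S'.Sym} {hφ : ∀ f, S'.arity (φ f) = S.arity f} {t : Term S}
    {p : List ℕ} {f : S.Sym} (h : t.fn p = some (Sum.inl f)) :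
    (t.map φ hφ).fn p = some (Sum.inl (φ f)) := by
  simp [map, h]

theorem map_fn_var_iff {φ : S.Sym → S'.Sym} {hφ : ∀ f, S'.arity (φ f) = S.arity f} {t : Term S}
    {p : List ℕ} {x : ℕ} :
    (t.map φ hφ).fn p = some (Sum.inr x) ↔ t.fn p = some (Sum.inr x) := by
  rcases h : t.fn p with _ | (f | y) <;> simp [map, h]

theorem map_positions {φ : S.Sym → S'.Sym} {hφ : ∀ f, S'.arity (φ f) = S.arity f} {t : Term S} :
    (t.map φ hφ).positions = t.positions := by
  ext p; simp [map, positions]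

theorem map_vars {φ : S.Sym → S'.Sym} {hφ : ∀ f, S'.arity (φ f) = S.arity f} {t : Term S} :
    (t.map φ hφ).vars = t.vars := by
  ext x; simp [vars, map_fn_var_iff]

theorem map_sub {φ : S.Sym → S'.Sym} {hφ : ∀ f, S'.arity (φ f) = S.arity f} {t : Term S}
    {p : List ℕ} (hp : p ∈ t.positions) : (t.map φ hφ).sub p = (t.sub p).map φ hφ := by
  ext q : 2
  rw [sub_fn _ (by rwa [map_positions])]
  simp [map, t.sub_fn hp]

theorem subst_cases (σ : ℕ → Term S) (t : Term S) (p : List ℕ) :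
    (∃ q x r, p = q ++ r ∧ t.fn q = some (Sum.inr x) ∧ (t.subst σ).fn p = (σ x).fn r) ∨
    ((∀ q x, q <+: p → t.fn q ≠ some (Sum.inr x)) ∧ (t.subst σ).fn p = t.fn p) := by
  by_cases h : ∀ q x, q <+: p → t.fn q ≠ some (Sum.inr x)
  · exact Or.inr ⟨h, subst_fn_of_not σ t p h⟩
  · push Not at h
    obtain ⟨q, x, ⟨r, rfl⟩, hx⟩ := h
    exact Or.inl ⟨q, x, r, rfl, hx, subst_fn_of_var σ t hx r⟩

theorem subst_fn_fun (σ : ℕ → Term S) (t : Term S) {p : List ℕ} {f : S.Sym}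
    (h : t.fn p = some (Sum.inl f)) : (t.subst σ).fn p = some (Sum.inl f) := by
  rw [subst_fn_of_not σ t p, h]
  intro q x hq hx
  obtain ⟨g, hg⟩ := t.fun_of_prefix h hq
  simp [hx] at hg

theorem subst_positions (σ : ℕ → Term S) (t : Term S) : t.positions ⊆ (t.subst σ).positions := by
  intro p hp
  rcases h : t.fn p with _ | (f | x)
  · simp [positions, h] at hp
  · exact mem_positions_of_fn _ (subst_fn_fun σ t h)
  · have := subst_fn_of_var σ t h []
    simp only [List.append_nil] at this
    simpa [positions, this] using (σ x).root_isSome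

theorem subst_of_root_var (σ : ℕ → Term S) (t : Term S) {x : ℕ}
    (h : t.fn [] = some (Sum.inr x)) : t.subst σ = σ x := by
  ext p : 2
  simpa using subst_fn_of_var σ t h p

theorem sub_subst (σ : ℕ → Term S) (t : Term S) {p : List ℕ} (hp : p ∈ t.positions) :
    (t.subst σ).sub p = (t.sub p).subst σ := by
  ext q : 2
  rw [sub_fn _ (subst_positions σ t hp)]
  rcases subst_cases σ (t.sub p) q with ⟨a, x, b, rfl, hx, h⟩ | ⟨hn, h⟩
  · rw [h, ← List.append_assoc, subst_fn_of_var σ t (by rwa [sub_fn _ hp] at hx)]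
  · rw [h, sub_fn _ hp]
    apply subst_fn_of_not
    intro r x hr hx
    rcases List.prefix_or_prefix_of_prefix hr (List.prefix_append p q) with h1 | h1
    · obtain ⟨b, rfl⟩ := h1
      obtain rfl := t.eq_nil_of_var hx hp
      refine hn [] x List.nil_prefix ?_
      rw [sub_fn _ hp]
      simpa using hx
    · obtain ⟨b, rfl⟩ := h1
      exact hn b x ((List.prefix_append_right_inj p).1 hr) (by rwa [sub_fn _ hp])

theorem sub_subst_var (σ : ℕ → Term S) (t : Term S) {p : List ℕ} {x : ℕ}
    (hp : t.fn p = some (Sum.inr x)) : (t.subst σ).sub p = σ x := by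
  have hp' := t.mem_positions_of_fn hp
  rw [sub_subst σ t hp', subst_of_root_var]
  simpa [sub_fn _ hp'] using hp

theorem subst_congr {σ τ : ℕ → Term S} {t : Term S} (h : ∀ x ∈ t.vars, σ x = τ x) :
    t.subst σ = t.subst τ := by
  ext p : 2
  rcases subst_cases σ t p with ⟨q, x, r, rfl, hx, hp⟩ | ⟨hn, hp⟩
  · rw [hp, subst_fn_of_var τ t hx, h x ⟨q, hx⟩]
  · rw [hp, subst_fn_of_not τ t p hn]

theorem subst_subst (σ τ : ℕ → Term S) (t : Term S) :
    (t.subst σ).subst τ = t.subst (fun x => (σ x).subst τ) := by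
  ext p : 2
  rcases subst_cases σ t p with ⟨q, x, r, rfl, hx, hp⟩ | ⟨hn, hp⟩
  · have hq : q ∈ (t.subst σ).positions := subst_positions σ t (t.mem_positions_of_fn hx)
    rw [subst_fn_of_var _ t hx, ← sub_fn _ (subst_positions _ _ hq), sub_subst _ _ hq,
      sub_subst_var σ t hx]
  · rw [subst_fn_of_not _ t p hn, ← hp]
    apply subst_fn_of_not
    intro q x hq hx
    rcases subst_cases σ t q with ⟨a, y, b, rfl, hy, -⟩ | ⟨hn', hp'⟩
    · exact hn a y ((List.prefix_append a b).trans hq) hy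
    · exact hn q x hq (hp' ▸ hx)

theorem map_subst {φ : S.Sym → S'.Sym} {hφ : ∀ f, S'.arity (φ f) = S.arity f} (σ : ℕ → Term S)
    (t : Term S) :
    (t.subst σ).map φ hφ = (t.map φ hφ).subst (fun x => (σ x).map φ hφ) := by
  ext p : 2
  rcases subst_cases σ t p with ⟨q, x, r, rfl, hx, hp⟩ | ⟨hn, hp⟩
  · rw [subst_fn_of_var _ _ (map_fn_var_iff.2 hx)]
    simp [map, hp]
  · rw [subst_fn_of_not _ _ p]
    · simp [map, hp]
    · intro q x hq hx
      exact hn q x hq (map_fn_var_iff.1 hx)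

theorem replace_fn_append (t u : Term S) {p : List ℕ} (hp : p ∈ t.positions) (q : List ℕ) :
    (t.replace p hp u).fn (p ++ q) = u.fn q := by simp [replace]

theorem replace_fn_of_not (t u : Term S) {p q : List ℕ} (hp : p ∈ t.positions)
    (h : ¬ p <+: q) : (t.replace p hp u).fn q = t.fn q := by simp [replace, h]

theorem mem_positions_replace (t u : Term S) {p : List ℕ} (hp : p ∈ t.positions) :
    p ∈ (t.replace p hp u).positions := by
  have := replace_fn_append t u hp []
  simp only [List.append_nil] at this
  simpa [positions, this] using u.root_isSome

/-- A term that has `u` at `p` and agrees with `t` elsewhere is `t[u]_p`. -/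
theorem eq_replace {t u v : Term S} {p : List ℕ} (hp : p ∈ t.positions)
    (h1 : ∀ q, v.fn (p ++ q) = u.fn q) (h2 : ∀ q, ¬ p <+: q → v.fn q = t.fn q) :
    v = t.replace p hp u := by
  ext q : 2
  by_cases h : p <+: q
  · obtain ⟨r, rfl⟩ := h
    rw [h1, replace_fn_append]
  · rw [h2 q h, replace_fn_of_not _ _ _ h]

theorem replace_self (t : Term S) {p : List ℕ} (hp : p ∈ t.positions) :
    t.replace p hp (t.sub p) = t :=
  (eq_replace hp (fun q => (t.sub_fn hp q).symm) (fun _ _ => rfl)).symm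

theorem replace_nil (t u : Term S) (h : [] ∈ t.positions) : t.replace [] h u = u :=
  (eq_replace h (fun _ => rfl) (fun _ hq => absurd List.nil_prefix hq)).symm

theorem map_replace {φ : S.Sym → S'.Sym} {hφ : ∀ f, S'.arity (φ f) = S.arity f} (t u : Term S)
    {p : List ℕ} (hp : p ∈ t.positions) (hp' : p ∈ (t.map φ hφ).positions) :
    (t.replace p hp u).map φ hφ = (t.map φ hφ).replace p hp' (u.map φ hφ) := by
  apply eq_replace
  · intro q; simp [map, replace_fn_append]
  · intro q hq; simp [map, replace_fn_of_not _ _ _ hq]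

theorem replace_subst (σ : ℕ → Term S) (t u : Term S) {p : List ℕ} (hp : p ∈ t.positions)
    (hp' : p ∈ (t.subst σ).positions) :
    (t.replace p hp u).subst σ = (t.subst σ).replace p hp' (u.subst σ) := by
  have hr := mem_positions_replace t u hp
  apply eq_replace
  · intro q
    rw [← sub_fn _ (subst_positions σ _ hr), sub_subst _ _ hr]
    congr 2
    ext r : 2
    rw [sub_fn _ hr, replace_fn_append]
  · intro q hq
    rcases subst_cases σ t q with ⟨a, x, b, rfl, hx, h⟩ | ⟨hn, h⟩
    · rw [h, subst_fn_of_var]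
      rw [replace_fn_of_not, hx]
      exact fun h => hq (h.trans (List.prefix_append _ _))
    · rw [h, subst_fn_of_not, replace_fn_of_not _ _ _ hq]
      intro r x hr hx
      rw [replace_fn_of_not _ _ _ (fun h => hq (h.trans hr))] at hx
      exact hn r x hr hx

/-! ### Matching a linear term -/

open Classical in
/-- The substitution that maps a variable of `m` to the subterm of `t` at the position of that
variable. -/
noncomputable def matcher (m : Term S) (t : Term S') (x : ℕ) : Term S' :=
  if h : ∃ q, m.fn q = some (Sum.inr x) then t.sub h.choose else ofVar x

theorem matcher_eq {m : Term S} (hm : m.IsLinear) (t : Term S') {q : List ℕ} {x : ℕ}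
    (h : m.fn q = some (Sum.inr x)) : matcher m t x = t.sub q := by
  have h' : ∃ q, m.fn q = some (Sum.inr x) := ⟨q, h⟩
  rw [matcher, dif_pos h', hm _ _ _ h'.choose_spec h]

theorem matcher_subst {m : Term S} (hm : m.IsLinear) (σ : ℕ → Term S) {x : ℕ}
    (hx : x ∈ m.vars) : matcher m (m.subst σ) x = σ x := by
  obtain ⟨q, hq⟩ := hx
  rw [matcher_eq hm _ hq, sub_subst_var _ _ hq]

/-- `t` has the function symbols of `m` at all function symbol positions of `m`. -/
def Matches (m t : Term S) : Prop :=
  ∀ q f, m.fn q = some (Sum.inl f) → t.fn q = some (Sum.inl f)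

theorem Matches.positions {m t : Term S} (h : Matches m t) : m.positions ⊆ t.positions := by
  intro p hp
  induction p using List.reverseRecOn with
  | nil => exact t.nil_mem_positions
  | append_singleton p i _ =>
    obtain ⟨f, hf, hi⟩ := (m.child_isSome p i).1 hp
    exact (t.child_mem_positions (h p f hf)).2 hi

/-- Matching a linear term is a condition on its function symbols only. -/
theorem Matches.eq_subst {m t : Term S} (hm : m.IsLinear) (h : Matches m t) :
    t = m.subst (matcher m t) := by
  ext p : 2
  rcases subst_cases (matcher m t) m p with ⟨q, x, r, rfl, hx, hp⟩ | ⟨hn, hp⟩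
  · rw [hp, matcher_eq hm _ hx, sub_fn _ (h.positions (m.mem_positions_of_fn hx))]
  · rw [hp]
    clear hp
    induction p using List.reverseRecOn with
    | nil =>
      rcases hm0 : m.fn [] with _ | (f | x)
      · simpa [hm0] using m.root_isSome
      · exact h _ _ hm0
      · exact absurd hm0 (hn [] x (List.prefix_refl _))
    | append_singleton p i ih =>
      have ih' := ih (fun q x hq => hn q x (hq.trans (List.prefix_append _ _)))
      rcases hmp : m.fn (p ++ [i]) with _ | (f | x)
      · have h1 : ¬ (m.fn (p ++ [i])).isSome := by simp [hmp]
        rw [m.child_isSome, ← ih', ← t.child_isSome] at h1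
        simpa using h1
      · exact h _ _ hmp
      · exact absurd hmp (hn _ x (List.prefix_refl _))

theorem matches_subst (m : Term S) (σ : ℕ → Term S) : Matches m (m.subst σ) :=
  fun _ _ h => subst_fn_fun σ m h

/-! ### Agreement up to a depth, and the metric -/

/-- The terms coincide at all positions of length less than `n`. -/
def Agree (n : ℕ) (s t : Term S) : Prop := ∀ p : List ℕ, p.length < n → s.fn p = t.fn p

theorem Agree.mono {m n : ℕ} (h : m ≤ n) {s t : Term S} (hst : Agree n s t) : Agree m s t :=
  fun p hp => hst p (hp.trans_le h)

theorem Agree.symm {n : ℕ} {s t : Term S} (h : Agree n s t) : Agree n t s :=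
  fun p hp => (h p hp).symm

theorem Agree.trans {n : ℕ} {s t v : Term S} (h : Agree n s t) (h' : Agree n t v) :
    Agree n s v := fun p hp => (h p hp).trans (h' p hp)

theorem eq_of_agree {s t : Term S} (h : ∀ n, Agree n s t) : s = t := by
  ext p : 2
  exact h (p.length + 1) p (Nat.lt_succ_self _)

theorem agree_of_distance_lt {n : ℕ} {s t : Term S} (h : s.distance t < (2 : ℝ)⁻¹ ^ n) :
    Agree n s t := by
  intro p hp
  by_contra hne
  have hst : s ≠ t := fun h => hne (by rw [h])
  rw [distance, if_neg hst] at h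
  have hk : sInf {k : ℕ | ∃ p : List ℕ, p.length = k ∧ s.fn p ≠ t.fn p} ≤ p.length :=
    Nat.sInf_le ⟨p, rfl, hne⟩
  have := pow_le_pow_of_le_one (a := (2 : ℝ)⁻¹) (by norm_num) (by norm_num) (hk.trans hp.le)
  linarith

theorem distance_le_of_agree {n : ℕ} {s t : Term S} (h : Agree n s t) :
    s.distance t ≤ (2 : ℝ)⁻¹ ^ n := by
  unfold distance
  split_ifs with hst
  · positivity
  · apply pow_le_pow_of_le_one (by norm_num) (by norm_num)
    have hne : {k : ℕ | ∃ p : List ℕ, p.length = k ∧ s.fn p ≠ t.fn p}.Nonempty := by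
      by_contra hem
      apply hst
      ext p : 2
      by_contra hp
      exact hem ⟨_, p, rfl, hp⟩
    obtain ⟨p, hp, hne⟩ := Nat.sInf_mem hne
    rw [← hp]
    by_contra hlt
    exact hne (h p (not_le.1 hlt))

theorem Agree.sub {n : ℕ} {s t : Term S} {p : List ℕ} (h : Agree (p.length + n) s t) :
    Agree n (s.sub p) (t.sub p) := by
  intro q hq
  have hp : s.fn p = t.fn p := h p (by omega)
  by_cases hs : p ∈ s.positions
  · have ht : p ∈ t.positions := by simpa [positions, ← hp] using hs
    rw [sub_fn _ hs, sub_fn _ ht]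
    exact h _ (by simpa using hq)
  · have ht : p ∉ t.positions := by simpa [positions, ← hp] using hs
    simp only [Term.sub, dif_neg hs, dif_neg ht]
    exact h q (by omega)

theorem Agree.subst {n : ℕ} {σ τ : ℕ → Term S} {t : Term S}
    (h : ∀ x ∈ t.vars, Agree n (σ x) (τ x)) : Agree n (t.subst σ) (t.subst τ) := by
  intro p hp
  rcases subst_cases σ t p with ⟨q, x, r, rfl, hx, h1⟩ | ⟨hn, h1⟩
  · rw [h1, subst_fn_of_var _ _ hx]
    exact h x ⟨q, hx⟩ r (by simp at hp; omega)
  · rw [h1, subst_fn_of_not _ _ _ hn]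

/-- Arities are finite, so there are finitely many positions of each length. -/
theorem finite_positions_length (t : Term S) (n : ℕ) :
    {p | p ∈ t.positions ∧ p.length = n}.Finite := by
  induction n with
  | zero => exact (Set.finite_singleton []).subset (fun p hp => List.length_eq_zero_iff.1 hp.2)
  | succ n ih =>
    have hf : ∀ p : List ℕ, {i : ℕ | p ++ [i] ∈ t.positions}.Finite := by
      intro p
      rcases h : t.fn p with _ | (f | x)
      · refine Set.finite_empty.subset fun i hi => ?_
        obtain ⟨f, hf, _⟩ := (t.child_isSome p i).1 hi
        simp [h] at hf
      · exact (Set.finite_lt_nat (S.arity f)).subset fun i hi => (t.child_mem_positions h).1 hi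
      · refine Set.finite_empty.subset fun i hi => ?_
        obtain ⟨f, hf, _⟩ := (t.child_isSome p i).1 hi
        simp [h] at hf
    refine (ih.biUnion (fun p _ => (hf p).image (fun i => p ++ [i]))).subset ?_
    rintro p ⟨hp, hl⟩
    have hne : p ≠ [] := by rintro rfl; simp at hl
    obtain ⟨q, i, rfl⟩ : ∃ q i, p = q ++ [i] := ⟨_, _, (List.dropLast_append_getLast hne).symm⟩
    simp only [List.length_append, List.length_singleton, Nat.add_right_cancel_iff] at hl
    exact Set.mem_biUnion (show q ∈ _ from ⟨t.isSome_of_append hp, hl⟩) ⟨i, hp, rfl⟩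

theorem finite_positions_length_lt (t : Term S) (n : ℕ) :
    {p | p ∈ t.positions ∧ p.length < n}.Finite := by
  refine ((Set.finite_lt_nat n).biUnion fun k _ => t.finite_positions_length k).subset ?_
  rintro p ⟨hp, hl⟩
  exact Set.mem_biUnion (show p.length ∈ {k | k < n} from hl) ⟨hp, rfl⟩

end Term

/-! ### Reduction sequences: invariants -/

namespace ITRS

open Term

variable {S : Signature.{u}}

/-- A property that is preserved by the steps of `R` and closed under limits of terms is preserved
by strongly convergent reductions. -/
theorem InfRed.invariant {R : ITRS S} {P : Term S → Prop}
    (hstep : ∀ p s t, R.StepAt p s t → P s → P t)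
    (hlim : ∀ t, (∀ n, ∃ s, P s ∧ Agree n s t) → P t)
    {s t : Term S} (h : R.InfRed s t) (hs : P s) : P t := by
  obtain ⟨α, a, p, rfl, rfl, hst, hl⟩ := h
  suffices H : ∀ β, β ≤ α → P (a β) from H α le_rfl
  intro β
  induction β using Ordinal.limitRecOn with
  | zero => exact fun _ => hs
  | add_one β ih =>
    intro hβ
    have hβ' : β < α := lt_of_lt_of_le (Order.lt_succ β) hβ
    exact hstep _ _ _ (hst β hβ') (ih hβ'.le)
  | limit l hlim' ih =>
    intro hβ
    refine hlim _ fun n => ?_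
    obtain ⟨γ, hγ, h⟩ := (hl l hβ hlim').1 ((2 : ℝ)⁻¹ ^ n) (by positivity)
    exact ⟨a γ, ih γ hγ (hγ.le.trans hβ), agree_of_distance_lt (h γ le_rfl hγ)⟩

/-- Finitely many rules with finite left-hand sides: the depths of the left-hand sides are
bounded. -/
theorem exists_depth_bound (R : ITRS S) :
    ∃ D : ℕ, ∀ ρ ∈ R.rules, ∀ p ∈ ρ.lhs.positions, p.length ≤ D := by
  have h : (⋃ ρ ∈ R.rules, List.length '' ρ.lhs.positions).Finite :=
    R.finite.biUnion fun ρ _ => ρ.lhs_finite.image _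
  obtain ⟨D, hD⟩ := h.bddAbove
  exact ⟨D, fun ρ hρ p hp => hD (Set.mem_biUnion hρ ⟨p, hp, rfl⟩)⟩

theorem StepAt.sub {R : ITRS S} {c p : List ℕ} {s t : Term S} (h : R.StepAt (c ++ p) s t) :
    R.StepAt p (s.sub c) (t.sub c) := by
  obtain ⟨hp, ρ, hρ, σ, hσ, rfl⟩ := h
  have hc : c ∈ s.positions := s.isSome_of_append hp
  have hc' : c ∈ (s.replace _ hp (ρ.rhs.subst σ)).positions :=
    isSome_of_append _ (q := p) (mem_positions_replace _ _ hp)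
  have hp' : p ∈ (s.sub c).positions := by simpa [positions, sub_fn _ hc] using hp
  refine ⟨hp', ρ, hρ, σ, ?_, ?_⟩
  · rw [← sub_eq_subterm, sub_sub _ hp, sub_eq_subterm _ hp, hσ]
  · apply eq_replace
    · intro q
      rw [sub_fn _ hc', ← List.append_assoc, replace_fn_append]
    · intro q hq
      rw [sub_fn _ hc', sub_fn _ hc, replace_fn_of_not]
      exact fun h => hq ((List.prefix_append_right_inj c).1 h)

/-! ### Labelled terms -/

variable (R : ITRS S)

/-- The symbol `f`, as an unlabelled symbol of the labelled signature. -/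
def plain (f : S.Sym) : R.labelledSig.Sym := Sum.inl f

/-- The symbol `f` with the label `ρ`. -/
def withLabel (f : S.Sym) (ρ : R.rules) : R.labelledSig.Sym := Sum.inr (f, ρ)

theorem plain_or_withLabel (g : R.labelledSig.Sym) :
    (∃ f, g = R.plain f) ∨ ∃ f ρ, g = R.withLabel f ρ := by
  rcases g with f | ⟨f, ρ⟩
  · exact Or.inl ⟨f, rfl⟩
  · exact Or.inr ⟨f, ρ, rfl⟩

variable {R} in
theorem plain_ne_withLabel {f g : S.Sym} {ρ : R.rules} : R.plain f ≠ R.withLabel g ρ :=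
  fun h => Sum.inl_ne_inr h

variable {R} in
theorem withLabel_inj {f g : S.Sym} {ρ ρ' : R.rules} (h : R.withLabel f ρ = R.withLabel g ρ') :
    f = g ∧ ρ = ρ' := Prod.mk.inj (Sum.inr.inj h)

variable {R} in
theorem labelWith_fn_none {lab : List ℕ → Option R.rules} {t : Term S} {p : List ℕ} {f : S.Sym}
    (h : t.fn p = some (Sum.inl f)) (hl : lab p = none) :
    (R.labelWith lab t).fn p = some (Sum.inl (R.plain f)) := by
  change (t.fn p).map (R.labelSym (lab p)) = _
  rw [h, hl]; rfl

variable {R} in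
theorem labelWith_fn_some {lab : List ℕ → Option R.rules} {t : Term S} {p : List ℕ} {f : S.Sym}
    {ρ : R.rules} (h : t.fn p = some (Sum.inl f)) (hl : lab p = some ρ) :
    (R.labelWith lab t).fn p = some (Sum.inl (R.withLabel f ρ)) := by
  change (t.fn p).map (R.labelSym (lab p)) = _
  rw [h, hl]; rfl

variable {R} in
theorem labelWith_fn_eq_none {lab : List ℕ → Option R.rules} {t : Term S} {p : List ℕ} :
    (R.labelWith lab t).fn p = none ↔ t.fn p = none := Option.map_eq_none_iff

theorem arity_plain (f : S.Sym) : R.labelledSig.arity (R.plain f) = S.arity f := rfl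

theorem unlabelled_eq_map (t : Term S) : R.unlabelled t = t.map R.plain R.arity_plain := by
  ext p : 2
  rcases h : t.fn p with _ | (f | x)
  · rw [unlabelled, labelWith_fn_eq_none.2 h]
    simp [Term.map, h]
  · rw [unlabelled, labelWith_fn_none h rfl, map_fn_fun h]
  · rw [unlabelled, (R.labelWith_fn_eq_var _ _ _ _).2 h, map_fn_var_iff.2 h]

/-- The symbol without its label. -/
def forgetSym : R.labelledSig.Sym → S.Sym := Sum.elim id Prod.fst

theorem forgetSym_plain (f : S.Sym) : R.forgetSym (R.plain f) = f := rfl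

theorem forgetSym_withLabel (f : S.Sym) (ρ : R.rules) : R.forgetSym (R.withLabel f ρ) = f := rfl

theorem arity_forgetSym (g : R.labelledSig.Sym) :
    S.arity (R.forgetSym g) = R.labelledSig.arity g := by
  rcases g with f | ⟨f, ρ⟩ <;> rfl

/-- Removing all labels. -/
def forget (s : Term R.labelledSig) : Term S := s.map R.forgetSym R.arity_forgetSym

theorem forget_unlabelled (t : Term S) : R.forget (R.unlabelled t) = t := by
  ext p : 2
  rw [unlabelled_eq_map]
  rcases h : t.fn p with _ | (f | x) <;> simp [forget, Term.map, h, forgetSym_plain]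

theorem unlabelled_injective : Function.Injective R.unlabelled :=
  Function.LeftInverse.injective R.forget_unlabelled

theorem unlabelled_fn_fun {t : Term S} {p : List ℕ} {f : S.Sym}
    (h : t.fn p = some (Sum.inl f)) : (R.unlabelled t).fn p = some (Sum.inl (R.plain f)) :=
  labelWith_fn_none h rfl

theorem unlabelled_fn_var_iff {t : Term S} {p : List ℕ} {x : ℕ} :
    (R.unlabelled t).fn p = some (Sum.inr x) ↔ t.fn p = some (Sum.inr x) :=
  R.labelWith_fn_eq_var _ _ _ _

theorem unlabelled_positions (t : Term S) : (R.unlabelled t).positions = t.positions := by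
  rw [unlabelled_eq_map, map_positions]

theorem unlabelled_vars (t : Term S) : (R.unlabelled t).vars = t.vars := by
  rw [unlabelled_eq_map, map_vars]

theorem unlabelled_sub {t : Term S} {p : List ℕ} (hp : p ∈ t.positions) :
    (R.unlabelled t).sub p = R.unlabelled (t.sub p) := by
  rw [unlabelled_eq_map, map_sub hp, ← unlabelled_eq_map]

theorem unlabelled_subst (t : Term S) (σ : ℕ → Term S) :
    R.unlabelled (t.subst σ) = (R.unlabelled t).subst (fun x => R.unlabelled (σ x)) := by
  simp only [unlabelled_eq_map, map_subst]

/-- The position `p` of `s` carries a symbol labelled with `ρ`. -/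
def HasLabel (s : Term R.labelledSig) (p : List ℕ) (ρ : R.rules) : Prop :=
  ∃ f, s.fn p = some (Sum.inl (R.withLabel f ρ))

variable {R}

theorem HasLabel.unique {s : Term R.labelledSig} {p : List ℕ} {ρ ρ' : R.rules}
    (h : R.HasLabel s p ρ) (h' : R.HasLabel s p ρ') : ρ = ρ' := by
  obtain ⟨f, hf⟩ := h
  obtain ⟨f', hf'⟩ := h'
  rw [hf] at hf'
  exact (withLabel_inj (Sum.inl.inj (Option.some.inj hf'))).2

theorem HasLabel.mem_positions {s : Term R.labelledSig} {p : List ℕ} {ρ : R.rules}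
    (h : R.HasLabel s p ρ) : p ∈ s.positions :=
  s.mem_positions_of_fn h.choose_spec

theorem hasLabel_sub {s : Term R.labelledSig} {p q : List ℕ} {ρ : R.rules}
    (hp : p ∈ s.positions) : R.HasLabel (s.sub p) q ρ ↔ R.HasLabel s (p ++ q) ρ := by
  simp only [HasLabel, sub_fn _ hp]

theorem not_hasLabel_unlabelled (t : Term S) (p : List ℕ) (ρ : R.rules) :
    ¬ R.HasLabel (R.unlabelled t) p ρ := by
  rintro ⟨f, hf⟩
  rw [unlabelled_eq_map] at hf
  rcases h : t.fn p with _ | (g | x)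
  · simp [Term.map, h] at hf
  · rw [map_fn_fun h] at hf
    exact plain_ne_withLabel (Sum.inl.inj (Option.some.inj hf))
  · rw [map_fn_var_iff.2 h] at hf
    simp at hf

theorem not_hasLabel_of_fn {s : Term R.labelledSig} {p : List ℕ} {f : S.Sym}
    (h : s.fn p = some (Sum.inl (R.plain f))) (ρ : R.rules) : ¬ R.HasLabel s p ρ := by
  rintro ⟨g, hg⟩
  rw [h] at hg
  exact plain_ne_withLabel (Sum.inl.inj (Option.some.inj hg))

theorem fn_eq_unlabelled_forget {s : Term R.labelledSig} {p : List ℕ}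
    (h : ∀ ρ, ¬ R.HasLabel s p ρ) : (R.unlabelled (R.forget s)).fn p = s.fn p := by
  rw [unlabelled_eq_map]
  rcases hs : s.fn p with _ | (g | x)
  · simp [forget, Term.map, hs]
  · rcases R.plain_or_withLabel g with ⟨f, rfl⟩ | ⟨f, ρ, rfl⟩
    · simp [forget, Term.map, hs, forgetSym_plain]
    · exact absurd ⟨f, hs⟩ (h ρ)
  · simp [forget, Term.map, hs]

theorem labelledRule_lhs_fn_root (ρ : R.rules) :
    ∃ f, ρ.1.lhs.fn [] = some (Sum.inl f) ∧
      (R.labelledRule ρ).lhs.fn [] = some (Sum.inl (R.withLabel f ρ)) := by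
  rcases h : ρ.1.lhs.fn [] with _ | (f | x)
  · simpa [h] using ρ.1.lhs.root_isSome
  · exact ⟨f, rfl, labelWith_fn_some h (if_pos rfl)⟩
  · exact absurd ⟨x, h⟩ ρ.1.lhs_not_var

theorem labelledRule_lhs_fn_nil {ρ : R.rules} {f : S.Sym}
    (h : ρ.1.lhs.fn [] = some (Sum.inl f)) :
    (R.labelledRule ρ).lhs.fn [] = some (Sum.inl (R.withLabel f ρ)) :=
  labelWith_fn_some h (if_pos rfl)

theorem labelledRule_lhs_fn {ρ : R.rules} {q : List ℕ} {f : S.Sym} (hq : q ≠ [])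
    (h : ρ.1.lhs.fn q = some (Sum.inl f)) :
    (R.labelledRule ρ).lhs.fn q = some (Sum.inl (R.plain f)) :=
  labelWith_fn_none h (if_neg hq)

theorem labelledRule_lhs_fn_var {ρ : R.rules} {q : List ℕ} {x : ℕ} :
    (R.labelledRule ρ).lhs.fn q = some (Sum.inr x) ↔ ρ.1.lhs.fn q = some (Sum.inr x) :=
  R.labelWith_fn_eq_var _ _ _ _

theorem labelledRule_lhs_positions (ρ : R.rules) :
    (R.labelledRule ρ).lhs.positions = ρ.1.lhs.positions := by
  ext p; simp [labelledRule, labelWith, positions]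

theorem labelledRule_lhs_fun {ρ : R.rules} {q : List ℕ} {g : R.labelledSig.Sym}
    (h : (R.labelledRule ρ).lhs.fn q = some (Sum.inl g)) :
    ∃ f, ρ.1.lhs.fn q = some (Sum.inl f) ∧
      (q = [] ∧ g = R.withLabel f ρ ∨ q ≠ [] ∧ g = R.plain f) := by
  by_cases hq : q = []
  · subst hq
    obtain ⟨f, hf, hf'⟩ := labelledRule_lhs_fn_root ρ
    rw [h] at hf'
    exact ⟨f, hf, Or.inl ⟨rfl, Sum.inl.inj (Option.some.inj hf')⟩⟩
  · rcases h' : ρ.1.lhs.fn q with _ | (f | x)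
    · simp [labelledRule, labelWith, h'] at h
    · rw [labelledRule_lhs_fn hq h'] at h
      exact ⟨f, rfl, Or.inr ⟨hq, (Sum.inl.inj (Option.some.inj h)).symm⟩⟩
    · rw [labelledRule_lhs_fn_var.2 h'] at h
      simp at h

theorem LeftLinear.labelledRule (hR : R.LeftLinear) (ρ : R.rules) :
    (R.labelledRule ρ).lhs.IsLinear := fun p q x hp hq =>
  hR ρ.1 ρ.2 p q x (labelledRule_lhs_fn_var.1 hp) (labelledRule_lhs_fn_var.1 hq)

theorem hasLabel_labelledRule_subst (ρ : R.rules) (σ : ℕ → Term R.labelledSig) :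
    R.HasLabel ((R.labelledRule ρ).lhs.subst σ) [] ρ := by
  obtain ⟨f, -, hf⟩ := labelledRule_lhs_fn_root ρ
  exact ⟨f, subst_fn_fun _ _ hf⟩

variable (R) in
/-- Every label sits at the root of an instance of the left-hand side of the labelled rule; in
particular no other label occurs in the pattern. -/
def WellLabelled (s : Term R.labelledSig) : Prop :=
  ∀ p ρ, R.HasLabel s p ρ → Matches (R.labelledRule ρ).lhs (s.sub p)

theorem WellLabelled.sub {s : Term R.labelledSig} (h : R.WellLabelled s) {p : List ℕ}
    (hp : p ∈ s.positions) : R.WellLabelled (s.sub p) := by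
  intro q ρ hq
  rw [hasLabel_sub hp] at hq
  rw [sub_sub _ hq.mem_positions]
  exact h _ _ hq

theorem NonCollapsing.rhs_root (hR : R.NonCollapsing) (ρ : R.rules) :
    ∃ f, ρ.1.rhs.fn [] = some (Sum.inl f) := by
  rcases h : ρ.1.rhs.fn [] with _ | (f | x)
  · simpa [h] using ρ.1.rhs.root_isSome
  · exact ⟨f, rfl⟩
  · exact absurd ⟨x, h⟩ (hR ρ.1 ρ.2)

theorem stepAt_labelled_iff {p : List ℕ} {s t : Term R.labelledSig} :
    R.labelled.StepAt p s t ↔ ∃ (hp : p ∈ s.positions) (ρ : R.rules) (σ : _),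
      s.sub p = (R.labelledRule ρ).lhs.subst σ ∧
      t = s.replace p hp ((R.unlabelled ρ.1.rhs).subst σ) := by
  constructor
  · rintro ⟨hp, _, ⟨ρ, rfl⟩, σ, h, ht⟩
    exact ⟨hp, ρ, σ, by rw [sub_eq_subterm _ hp, h], ht⟩
  · rintro ⟨hp, ρ, σ, h, ht⟩
    exact ⟨hp, _, ⟨ρ, rfl⟩, σ, by rw [← sub_eq_subterm _ hp, h], ht⟩

theorem StepAt.hasLabel {p : List ℕ} {s t : Term R.labelledSig} (h : R.labelled.StepAt p s t) :
    ∃ ρ, R.HasLabel s p ρ := by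
  obtain ⟨hp, ρ, σ, hσ, -⟩ := stepAt_labelled_iff.1 h
  refine ⟨ρ, ?_⟩
  have := hasLabel_labelledRule_subst ρ σ
  rw [← hσ, hasLabel_sub hp] at this
  simpa using this

/-- A labelled position of a well-labelled term can be contracted. -/
theorem WellLabelled.exists_stepAt (hR : R.LeftLinear) {s : Term R.labelledSig}
    (hs : R.WellLabelled s) {p : List ℕ} {ρ : R.rules} (h : R.HasLabel s p ρ) :
    ∃ t, R.labelled.StepAt p s t :=
  ⟨_, stepAt_labelled_iff.2 ⟨h.mem_positions, ρ, _,
    (hs p ρ h).eq_subst (hR.labelledRule ρ), rfl⟩⟩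

/-- Steps preserve well-labelledness: a contraction takes place at a labelled position, hence
not properly inside the pattern of another labelled position. -/
theorem WellLabelled.step {p : List ℕ} {s t : Term R.labelledSig} (hs : R.WellLabelled s)
    (h : R.labelled.StepAt p s t) : R.WellLabelled t := by
  obtain ⟨ρ₀, hρ₀⟩ := h.hasLabel
  obtain ⟨hp, ρ, σ, hσ, rfl⟩ := stepAt_labelled_iff.1 h
  intro q ρ' hq k g hk
  have hqpos := hq.mem_positions
  rw [sub_fn _ hqpos]
  by_cases hpq : p <+: q
  · obtain ⟨q, rfl⟩ := hpq
    obtain ⟨f, hf⟩ := hq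
    rw [replace_fn_append] at hf
    rw [List.append_assoc, replace_fn_append]
    rcases subst_cases σ (R.unlabelled ρ.1.rhs) q with ⟨a, x, b, rfl, hx, h1⟩ | ⟨_, h1⟩
    · obtain ⟨c, hc⟩ := ρ.1.vars_subset ⟨a, (R.unlabelled_fn_var_iff).1 hx⟩
      have hsc : s.sub (p ++ c) = σ x := by
        rw [← sub_subst_var σ _ (labelledRule_lhs_fn_var.2 hc), ← hσ, sub_sub]
        have : c ∈ (s.sub p).positions := by
          rw [hσ]
          exact subst_positions _ _ (mem_positions_of_fn _ (labelledRule_lhs_fn_var.2 hc))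
        simpa [positions, sub_fn _ hp] using this
      have hpc : p ++ c ∈ s.positions := by
        have : c ∈ (s.sub p).positions := by
          rw [hσ]
          exact subst_positions _ _ (mem_positions_of_fn _ (labelledRule_lhs_fn_var.2 hc))
        simpa [positions, sub_fn _ hp] using this
      have hlab : R.HasLabel s (p ++ c ++ b) ρ' := by
        rw [← hasLabel_sub hpc, hsc]
        exact ⟨f, h1 ▸ hf⟩
      have := hs _ _ hlab k g hk
      rw [List.append_assoc, subst_fn_of_var σ _ hx, ← this, sub_fn _ hlab.mem_positions, ← hsc,
        sub_fn _ hpc]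
      simp
    · rw [h1] at hf
      exact absurd ⟨f, hf⟩ (not_hasLabel_unlabelled _ _ _)
  · obtain ⟨f, hf⟩ := hq
    rw [replace_fn_of_not _ _ _ hpq] at hf
    have hlab : R.HasLabel s q ρ' := ⟨f, hf⟩
    have hm := hs _ _ hlab
    have hk' := hm k g hk
    rw [sub_fn _ hlab.mem_positions] at hk'
    by_cases hpk : p <+: q ++ k
    · exfalso
      rcases List.prefix_or_prefix_of_prefix hpk (List.prefix_append q k) with h1 | h1
      · exact hpq h1
      · obtain ⟨a, rfl⟩ := h1
        have hak : a <+: k := (List.prefix_append_right_inj q).1 hpk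
        have ha : a ≠ [] := by rintro rfl; simp at hpq
        obtain ⟨g', hg'⟩ := fun_of_prefix _ hk hak
        obtain ⟨f', -, h2⟩ := labelledRule_lhs_fun hg'
        have h3 := hm a g' hg'
        rw [sub_fn _ hlab.mem_positions] at h3
        rcases h2 with ⟨h2, -⟩ | ⟨-, rfl⟩
        · exact ha h2
        · exact not_hasLabel_of_fn h3 _ hρ₀
    · rw [replace_fn_of_not _ _ _ hpk, hk']

theorem WellLabelled.limit {t : Term R.labelledSig}
    (h : ∀ n, ∃ s, R.WellLabelled s ∧ Agree n s t) : R.WellLabelled t := by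
  rintro q ρ ⟨f, hf⟩ k g hk
  obtain ⟨s, hs, hst⟩ := h (q.length + k.length + 1)
  have hq : s.fn q = t.fn q := hst q (by omega)
  have hlab : R.HasLabel s q ρ := ⟨f, hq ▸ hf⟩
  have := hs q ρ hlab k g hk
  rw [sub_fn _ hlab.mem_positions] at this
  rw [sub_fn _ (t.mem_positions_of_fn hf), ← hst _ (by simp), this]

end ITRS

/-! ### The development of a labelled term -/

namespace ITRS

open Term

variable {S : Signature.{u}} {R : ITRS S}

open Classical in
variable (R) in
/-- Contract the root of a labelled term if the root is labelled. Whether the pattern is present is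
not checked. -/
noncomputable def contractRoot (s : Term R.labelledSig) : Term R.labelledSig :=
  if h : ∃ ρ, R.HasLabel s [] ρ then
    (R.unlabelled h.choose.1.rhs).subst (matcher (R.labelledRule h.choose).lhs s)
  else s

theorem contractRoot_of_hasLabel {s : Term R.labelledSig} {ρ : R.rules}
    (h : R.HasLabel s [] ρ) :
    R.contractRoot s = (R.unlabelled ρ.1.rhs).subst (matcher (R.labelledRule ρ).lhs s) := by
  have h' : ∃ ρ, R.HasLabel s [] ρ := ⟨ρ, h⟩
  rw [contractRoot, dif_pos h', h'.choose_spec.unique h]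

theorem contractRoot_of_not {s : Term R.labelledSig} (h : ∀ ρ, ¬ R.HasLabel s [] ρ) :
    R.contractRoot s = s := by
  rw [contractRoot, dif_neg (fun ⟨ρ, h'⟩ => h ρ h')]

theorem vars_labelledRule (ρ : R.rules) :
    (R.unlabelled ρ.1.rhs).vars ⊆ (R.labelledRule ρ).lhs.vars := (R.labelledRule ρ).vars_subset

theorem contractRoot_subst (hR : R.LeftLinear) (ρ : R.rules) (σ : ℕ → Term R.labelledSig) :
    R.contractRoot ((R.labelledRule ρ).lhs.subst σ) = (R.unlabelled ρ.1.rhs).subst σ := by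
  rw [contractRoot_of_hasLabel (hasLabel_labelledRule_subst ρ σ)]
  exact subst_congr fun x hx => matcher_subst (hR.labelledRule ρ) σ (vars_labelledRule ρ hx)

theorem not_hasLabel_rhs_subst (hR : R.NonCollapsing) (ρ : R.rules)
    (σ : ℕ → Term R.labelledSig) (ρ' : R.rules) :
    ¬ R.HasLabel ((R.unlabelled ρ.1.rhs).subst σ) [] ρ' := by
  obtain ⟨f, hf⟩ := hR.rhs_root ρ
  exact not_hasLabel_of_fn (subst_fn_fun σ _ (R.unlabelled_fn_fun hf)) ρ'

/-- Right-hand sides are not variables, so a single contraction removes the label of the root. -/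
theorem not_hasLabel_contractRoot (hR : R.NonCollapsing) (s : Term R.labelledSig) (ρ : R.rules) :
    ¬ R.HasLabel (R.contractRoot s) [] ρ := by
  by_cases h : ∃ ρ, R.HasLabel s [] ρ
  · obtain ⟨ρ', h'⟩ := h
    rw [contractRoot_of_hasLabel h']
    exact not_hasLabel_rhs_subst hR _ _ _
  · rw [contractRoot_of_not (fun ρ h' => h ⟨ρ, h'⟩)]
    exact fun h' => h ⟨ρ, h'⟩

open Classical in
variable (R) in
/-- The symbol at a position of the development: contract the root, read off the symbol there, and
continue with the arguments. -/
noncomputable def devFn : List ℕ → Term R.labelledSig → Option (S.Sym ⊕ ℕ)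
  | [], s => (R.forget (R.contractRoot s)).fn []
  | i :: p, s =>
    if [i] ∈ (R.contractRoot s).positions then devFn p ((R.contractRoot s).sub [i]) else none

theorem devFn_child (p : List ℕ) (i : ℕ) (s : Term R.labelledSig) :
    (R.devFn (p ++ [i]) s).isSome ↔ ∃ f, R.devFn p s = some (Sum.inl f) ∧ i < S.arity f := by
  induction p generalizing s with
  | nil =>
    have h := (R.forget (R.contractRoot s)).child_isSome [] i
    simp only [List.nil_append] at h
    rw [List.nil_append]
    simp only [devFn]
    rw [← h]
    have hpos : ((R.forget (R.contractRoot s)).fn [i]).isSome ↔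
        [i] ∈ (R.contractRoot s).positions := by
      simp [forget, Term.map, positions]
    rw [hpos]
    split_ifs with h'
    · exact iff_of_true (root_isSome _) h'
    · exact iff_of_false (by simp) h'
  | cons j p ih =>
    simp only [List.cons_append, devFn]
    split_ifs with h
    · exact ih _
    · simp

variable (R) in
/-- The development of a labelled term: the term obtained by contracting all labels. -/
noncomputable def dev (s : Term R.labelledSig) : Term S where
  fn p := R.devFn p s
  root_isSome := by
    simp only [devFn]
    exact root_isSome _
  child_isSome p i := devFn_child p i s

theorem dev_fn_nil (s : Term R.labelledSig) :
    (R.dev s).fn [] = (R.forget (R.contractRoot s)).fn [] := rfl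

theorem dev_fn_cons {s : Term R.labelledSig} {i : ℕ} (h : [i] ∈ (R.contractRoot s).positions)
    (p : List ℕ) : (R.dev s).fn (i :: p) = (R.dev ((R.contractRoot s).sub [i])).fn p := by
  simp [dev, devFn, h]

theorem dev_fn_cons_none {s : Term R.labelledSig} {i : ℕ}
    (h : [i] ∉ (R.contractRoot s).positions) (p : List ℕ) : (R.dev s).fn (i :: p) = none := by
  simp [dev, devFn, h]

theorem dev_congr {s t : Term R.labelledSig} (h : R.contractRoot s = R.contractRoot t) :
    R.dev s = R.dev t := by
  ext p : 2
  cases p with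
  | nil => rw [dev_fn_nil, dev_fn_nil, h]
  | cons i p =>
    by_cases h' : [i] ∈ (R.contractRoot s).positions
    · rw [dev_fn_cons h', dev_fn_cons (h ▸ h'), h]
    · rw [dev_fn_cons_none h', dev_fn_cons_none (h ▸ h')]

theorem dev_contractRoot (hR : R.NonCollapsing) (s : Term R.labelledSig) :
    R.dev (R.contractRoot s) = R.dev s :=
  dev_congr (contractRoot_of_not (not_hasLabel_contractRoot hR s))

/-- At a position that has no labels above it or on it, nothing changes. -/
theorem dev_fn_of_no_label {s : Term R.labelledSig} {p : List ℕ}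
    (h : ∀ q ρ, q.length ≤ p.length → ¬ R.HasLabel s q ρ) :
    (R.dev s).fn p = (R.forget s).fn p := by
  have hroot : R.contractRoot s = s := contractRoot_of_not fun ρ => h [] ρ (by simp)
  induction p generalizing s with
  | nil => rw [dev_fn_nil, hroot]
  | cons i p ih =>
    by_cases h' : [i] ∈ s.positions
    · rw [dev_fn_cons (by rwa [hroot]), hroot, ih, forget, forget, ← map_sub h', sub_fn]
      · rfl
      · rwa [map_positions]
      · intro q ρ hq
        rw [hasLabel_sub h']
        exact h _ _ (by simpa using hq)
      · apply contractRoot_of_not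
        intro ρ
        rw [hasLabel_sub h']
        exact h _ _ (by simp)
    · rw [dev_fn_cons_none (by rwa [hroot]), fn_eq_none]
      rw [forget, map_positions]
      exact fun h'' => h' (isSome_of_append _ (q := p) h'')

theorem dev_unlabelled (t : Term S) : R.dev (R.unlabelled t) = t := by
  ext p : 2
  rw [dev_fn_of_no_label (fun q ρ _ => not_hasLabel_unlabelled t q ρ), forget_unlabelled]

theorem agree_unlabelled_dev {s : Term R.labelledSig} {n : ℕ}
    (h : ∀ q ρ, q.length < n → ¬ R.HasLabel s q ρ) : Agree n s (R.unlabelled (R.dev s)) := by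
  intro p hp
  rw [← fn_eq_unlabelled_forget (fun ρ => h p ρ hp)]
  have := dev_fn_of_no_label (s := s) (p := p) (fun q ρ hq => h q ρ (hq.trans_lt hp))
  simp only [unlabelled, labelWith, this]

/-- Development commutes with substitution into unlabelled terms. -/
theorem dev_unlabelled_subst (r : Term S) (σ : ℕ → Term R.labelledSig) :
    R.dev ((R.unlabelled r).subst σ) = r.subst (fun x => R.dev (σ x)) := by
  ext p : 2
  induction p generalizing r with
  | nil =>
    rcases hr : r.fn [] with _ | (f | x)
    · simpa [hr] using r.root_isSome
    · have h := subst_fn_fun σ _ (R.unlabelled_fn_fun hr)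
      rw [subst_fn_fun _ _ hr, dev_fn_nil, contractRoot_of_not (not_hasLabel_of_fn h), forget,
        map_fn_fun h, forgetSym_plain]
    · rw [subst_of_root_var _ _ (R.unlabelled_fn_var_iff.2 hr), subst_of_root_var _ _ hr]
  | cons i p ih =>
    rcases hr : r.fn [] with _ | (f | x)
    · simpa [hr] using r.root_isSome
    · have h := subst_fn_fun σ _ (R.unlabelled_fn_fun hr)
      have h0 := contractRoot_of_not (not_hasLabel_of_fn h)
      by_cases hi : i < S.arity f
      · have hi' : [i] ∈ r.positions := (r.child_mem_positions hr).2 hi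
        have hi2 : [i] ∈ (R.unlabelled r).positions := by rwa [unlabelled_positions]
        rw [dev_fn_cons (by rw [h0]; exact subst_positions _ _ hi2), h0, sub_subst _ _ hi2,
          unlabelled_sub R hi', ih, ← sub_subst _ _ hi', sub_fn _ (subst_positions _ _ hi')]
        rfl
      · have h1 : [i] ∉ ((R.unlabelled r).subst σ).positions :=
          fun h' => hi ((child_mem_positions _ h).1 h')
        rw [dev_fn_cons_none (by rwa [h0]), fn_eq_none]
        intro h'
        exact hi ((child_mem_positions _ (subst_fn_fun _ _ hr)).1 (isSome_of_append _ (q := p) h'))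
    · rw [subst_of_root_var _ _ (R.unlabelled_fn_var_iff.2 hr), subst_of_root_var _ _ hr]

theorem dev_of_hasLabel (hR : R.NonCollapsing) {s : Term R.labelledSig} {ρ : R.rules}
    (h : R.HasLabel s [] ρ) :
    R.dev s = ρ.1.rhs.subst (fun x => R.dev (matcher (R.labelledRule ρ).lhs s x)) := by
  rw [← dev_contractRoot hR, contractRoot_of_hasLabel h, dev_unlabelled_subst]

/-- A contraction does not change the development. -/
theorem dev_step (hl : R.LeftLinear) (hc : R.NonCollapsing) {p : List ℕ}
    {s t : Term R.labelledSig} (hs : R.WellLabelled s) (h : R.labelled.StepAt p s t) :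
    R.dev s = R.dev t := by
  induction hn : p.length using Nat.strong_induction_on generalizing p s t with
  | _ n ih =>
  obtain ⟨hp, ρ, σ, hσ, ht⟩ := stepAt_labelled_iff.1 h
  rcases p with _ | ⟨i, p⟩
  · rw [sub_nil] at hσ
    rw [replace_nil] at ht
    subst ht
    rw [← dev_contractRoot hc s, hσ, contractRoot_subst hl]
  have hnp : ∀ q, ¬ (i :: p) <+: q → t.fn q = s.fn q := by
    intro q hq
    rw [ht, replace_fn_of_not _ _ _ hq]
  have hroot : t.fn [] = s.fn [] := hnp _ (by simp)
  by_cases hlab : ∃ ρ', R.HasLabel s [] ρ'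
  · obtain ⟨ρ', hs'⟩ := hlab
    have ht' : R.HasLabel t [] ρ' := by
      obtain ⟨f, hf⟩ := hs'
      exact ⟨f, hroot.trans hf⟩
    have hms : Matches (R.labelledRule ρ').lhs s := by simpa [sub_nil] using hs _ _ hs'
    have hmt : Matches (R.labelledRule ρ').lhs t := by
      simpa [sub_nil] using hs.step h _ _ ht'
    rw [dev_of_hasLabel hc hs', dev_of_hasLabel hc ht']
    apply subst_congr
    intro x hx
    obtain ⟨c, hx'⟩ := ρ'.1.vars_subset hx
    have hx' := labelledRule_lhs_fn_var.2 hx'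
    rw [matcher_eq (hl.labelledRule ρ') _ hx', matcher_eq (hl.labelledRule ρ') _ hx']
    have hcs := hms.positions (mem_positions_of_fn _ hx')
    have hct := hmt.positions (mem_positions_of_fn _ hx')
    by_cases hcp : c <+: i :: p
    · obtain ⟨d, hd⟩ := hcp
      have hcne : c ≠ [] := by
        rintro rfl
        obtain ⟨f, -, hf⟩ := labelledRule_lhs_fn_root ρ'
        rw [hf] at hx'
        simp at hx'
      have hlen : d.length < n := by
        have := congrArg List.length hd
        have := List.length_pos_iff.2 hcne
        simp only [List.length_append] at *
        omega
      rw [← hd] at h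
      exact ih d.length hlen (hs.sub hcs) h.sub rfl
    · congr 1
      ext q : 2
      rw [sub_fn _ hcs, sub_fn _ hct, hnp]
      intro hq
      rcases List.prefix_or_prefix_of_prefix hq (List.prefix_append c q) with h1 | h1
      · obtain ⟨e, rfl⟩ := h1
        by_cases he : e = []
        · subst he
          exact hcp (by simp)
        · -- a labelled position cannot lie inside the pattern of another one
          obtain ⟨g, hg⟩ := exists_fun_of_append _ (by rw [hx']; rfl) he
          obtain ⟨f', -, h2⟩ := labelledRule_lhs_fun hg
          have h3 := hms _ _ hg
          obtain ⟨ρ₀, hρ₀⟩ := h.hasLabel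
          rcases h2 with ⟨h2, -⟩ | ⟨-, rfl⟩
          · simp at h2
          · exact not_hasLabel_of_fn h3 _ hρ₀
      · exact hcp h1
  · have hs0 : R.contractRoot s = s := contractRoot_of_not fun ρ h => hlab ⟨ρ, h⟩
    have ht0 : R.contractRoot t = t := contractRoot_of_not fun ρ ⟨f, hf⟩ =>
      hlab ⟨ρ, f, hroot ▸ hf⟩
    ext q : 2
    rcases q with _ | ⟨j, q⟩
    · rw [dev_fn_nil, dev_fn_nil, hs0, ht0]
      simp [forget, Term.map, hroot]
    · have hj : [j] ∈ t.positions ↔ [j] ∈ s.positions := by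
        have h1 := s.child_isSome [] j
        rw [← hroot, ← t.child_isSome] at h1
        exact h1.symm
      by_cases hjs : [j] ∈ s.positions
      · rw [dev_fn_cons (by rwa [hs0]), dev_fn_cons (by rwa [ht0, hj]), hs0, ht0]
        by_cases hji : j = i
        · subst hji
          exact congrArg (fun u => u.fn q)
            (ih p.length (by simp at hn; omega) (hs.sub hjs) (StepAt.sub (c := [j]) h) rfl)
        · congr 2
          ext k : 2
          rw [sub_fn _ hjs, sub_fn _ (hj.2 hjs), hnp]
          simpa using fun h => (hji h.symm).elim
      · rw [dev_fn_cons_none (by rwa [hs0]), dev_fn_cons_none (by rwa [ht0, hj])]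

variable (R) in
/-- Development is uniformly continuous. -/
theorem exists_agree_dev (n : ℕ) :
    ∃ k, ∀ s t : Term R.labelledSig, Agree k s t → Agree n (R.dev s) (R.dev t) := by
  obtain ⟨D, hD⟩ := R.exists_depth_bound
  have hroot : ∀ (d : ℕ) (s t : Term R.labelledSig), Agree (D + d + 1) s t →
      Agree d (R.contractRoot s) (R.contractRoot t) := by
    intro d s t hst
    by_cases h : ∃ ρ, R.HasLabel s [] ρ
    · obtain ⟨ρ, f, hf⟩ := h
      rw [contractRoot_of_hasLabel ⟨f, hf⟩,
        contractRoot_of_hasLabel ⟨f, (hst [] (by simp)).symm.trans hf⟩]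
      apply Agree.subst
      intro x _
      by_cases hx : ∃ q, (R.labelledRule ρ).lhs.fn q = some (Sum.inr x)
      · have hq := hD ρ.1 ρ.2 hx.choose
          (by rw [← labelledRule_lhs_positions]; exact mem_positions_of_fn _ hx.choose_spec)
        simp only [matcher, dif_pos hx]
        exact Agree.sub (hst.mono (by omega))
      · simp only [matcher, dif_neg hx]
        exact fun _ _ => rfl
    · rw [contractRoot_of_not (fun ρ h' => h ⟨ρ, h'⟩), contractRoot_of_not]
      · exact hst.mono (by omega)
      · rintro ρ ⟨f, hf⟩
        exact h ⟨ρ, f, (hst [] (by simp)).trans hf⟩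
  have key : ∀ (p : List ℕ) (s t : Term R.labelledSig),
      Agree ((p.length + 1) * (D + 2)) s t → (R.dev s).fn p = (R.dev t).fn p := by
    intro p
    induction p with
    | nil =>
      intro s t hst
      have := hroot 1 s t (hst.mono (by simp)) [] (by simp)
      simp [dev_fn_nil, forget, Term.map, this]
    | cons i p ih =>
      intro s t hst
      have h1 := hroot (1 + (p.length + 1) * (D + 2)) s t
        (hst.mono (by simp only [List.length_cons]; ring_nf; omega))
      have h2 : [i] ∈ (R.contractRoot s).positions ↔ [i] ∈ (R.contractRoot t).positions := by
        have := h1 [i] (by simp)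
        simp only [positions, Set.mem_ofPred_eq, this]
      by_cases h3 : [i] ∈ (R.contractRoot s).positions
      · rw [dev_fn_cons h3, dev_fn_cons (h2.1 h3)]
        exact ih _ _ (Agree.sub (by simpa using h1))
      · rw [dev_fn_cons_none h3, dev_fn_cons_none (fun h => h3 (h2.2 h))]
  refine ⟨n * (D + 2), fun s t hst p hp => key p s t (hst.mono ?_)⟩
  exact Nat.mul_le_mul_right _ hp

/-- Reductions preserve well-labelledness and the development. -/
theorem dev_of_infRed (hl : R.LeftLinear) (hc : R.NonCollapsing) {s t : Term R.labelledSig}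
    (hs : R.WellLabelled s) (h : R.labelled.InfRed s t) :
    R.WellLabelled t ∧ R.dev t = R.dev s := by
  refine h.invariant (P := fun t => R.WellLabelled t ∧ R.dev t = R.dev s) ?_ ?_ ⟨hs, rfl⟩
  · rintro p a b hab ⟨ha, had⟩
    exact ⟨ha.step hab, (dev_step hl hc ha hab).symm.trans had⟩
  · intro b hb
    refine ⟨WellLabelled.limit fun n => ?_, eq_of_agree fun n => ?_⟩
    · obtain ⟨a, ha, hab⟩ := hb n
      exact ⟨a, ha.1, hab⟩
    · obtain ⟨k, hk⟩ := R.exists_agree_dev n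
      obtain ⟨a, ha, hab⟩ := hb k
      rw [← ha.2]
      exact (hk _ _ hab).symm

end ITRS

/-! ### Existence of developments -/

namespace ITRS

open Term

variable {S : Signature.{u}} {R : ITRS S}

/-- A sequence of steps of length `ω`, with depths tending to infinity, that converges. -/
theorem InfRed.of_nat {R : ITRS S} {a : ℕ → Term S} {p : ℕ → List ℕ} {t : Term S}
    (hstep : ∀ n, R.StepAt (p n) (a n) (a (n + 1)))
    (hlim : ∀ d, ∃ N, ∀ n, N ≤ n → Agree d (a n) t ∧ d ≤ (p n).length) : R.InfRed (a 0) t := by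
  obtain ⟨idx, hidx⟩ : ∃ idx : Ordinal.{0} → ℕ, ∀ n : ℕ, idx n = n :=
    ⟨Function.invFun (Nat.cast : ℕ → Ordinal.{0}), Function.leftInverse_invFun Nat.cast_injective⟩
  classical
  refine ⟨Ordinal.omega0, fun β => if β < Ordinal.omega0 then a (idx β) else t,
    fun β => p (idx β), ?_, ?_, ?_, ?_⟩
  · simp only [if_pos Ordinal.omega0_pos]
    rw [← Nat.cast_zero, hidx]
  · simp
  · intro β hβ
    obtain ⟨n, rfl⟩ := Ordinal.lt_omega0.1 hβ
    have hs : Order.succ (n : Ordinal.{0}) = ((n + 1 : ℕ) : Ordinal.{0}) := by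
      simp
    rw [hs]
    simp only [if_pos (Ordinal.natCast_lt_omega0 _), hidx]
    exact hstep n
  · intro l hl hlim'
    obtain rfl : l = Ordinal.omega0 := le_antisymm hl (Ordinal.omega0_le_of_isSuccLimit hlim')
    constructor
    · intro ε hε
      obtain ⟨d, hd⟩ := exists_pow_lt_of_lt_one hε (show (2 : ℝ)⁻¹ < 1 by norm_num)
      obtain ⟨N, hN⟩ := hlim d
      refine ⟨N, Ordinal.natCast_lt_omega0 N, fun β hβ hβ' => ?_⟩
      obtain ⟨n, rfl⟩ := Ordinal.lt_omega0.1 hβ'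
      simp only [if_pos hβ', hidx, lt_irrefl, if_false]
      exact (distance_le_of_agree (hN n (by exact_mod_cast hβ)).1).trans_lt hd
    · intro d
      obtain ⟨N, hN⟩ := hlim d
      refine ⟨N, Ordinal.natCast_lt_omega0 N, fun β hβ hβ' => ?_⟩
      obtain ⟨n, rfl⟩ := Ordinal.lt_omega0.1 hβ'
      simp only [hidx]
      exact (hN n (by exact_mod_cast hβ)).2

/-- Finitely many steps. -/
theorem InfRed.of_fin {R : ITRS S} {a : ℕ → Term S} {p : ℕ → List ℕ} {N : ℕ}
    (hstep : ∀ n, n < N → R.StepAt (p n) (a n) (a (n + 1))) : R.InfRed (a 0) (a N) := by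
  obtain ⟨idx, hidx⟩ : ∃ idx : Ordinal.{0} → ℕ, ∀ n : ℕ, idx n = n :=
    ⟨Function.invFun (Nat.cast : ℕ → Ordinal.{0}), Function.leftInverse_invFun Nat.cast_injective⟩
  refine ⟨N, fun β => a (idx β), fun β => p (idx β), ?_, ?_, ?_, ?_⟩
  · change a (idx 0) = a 0
    rw [← Nat.cast_zero, hidx]
  · change a (idx N) = a N
    rw [hidx]
  · intro β hβ
    obtain ⟨n, rfl⟩ := Ordinal.lt_omega0.1 (hβ.trans (Ordinal.natCast_lt_omega0 N))
    have hs : Order.succ (n : Ordinal.{0}) = ((n + 1 : ℕ) : Ordinal.{0}) := by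
      simp
    rw [hs]
    simp only [hidx]
    exact hstep n (by exact_mod_cast hβ)
  · intro l hl hlim'
    exact absurd ((Ordinal.omega0_le_of_isSuccLimit hlim').trans hl)
      (not_le.2 (Ordinal.natCast_lt_omega0 N))

/-- After a contraction at a labelled position of minimal depth, the labels up to this depth are
the same as before, except that the contracted one has disappeared. -/
theorem hasLabel_step_iff (hc : R.NonCollapsing) {p : List ℕ} {s t : Term R.labelledSig}
    (h : R.labelled.StepAt p s t) {q : List ℕ} (hq : q.length ≤ p.length) :
    (∃ ρ, R.HasLabel t q ρ) ↔ (∃ ρ, R.HasLabel s q ρ) ∧ q ≠ p := by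
  obtain ⟨hp, ρ, σ, -, rfl⟩ := stepAt_labelled_iff.1 h
  by_cases hqp : p <+: q
  · obtain rfl := hqp.eq_of_length_le hq
    refine iff_of_false ?_ (by simp)
    rintro ⟨ρ', f, hf⟩
    have := replace_fn_append s ((R.unlabelled ρ.1.rhs).subst σ) hp []
    rw [List.append_nil] at this
    rw [this] at hf
    exact not_hasLabel_rhs_subst hc ρ σ ρ' ⟨f, hf⟩
  · simp only [HasLabel, replace_fn_of_not _ _ _ hqp]
    refine (and_iff_left ?_).symm
    rintro rfl
    exact hqp (List.prefix_refl _)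

/-- If every step contracts a label of minimal depth, then the labels move to infinity. -/
theorem exists_no_label_below (hc : R.NonCollapsing) {a : ℕ → Term R.labelledSig}
    {p : ℕ → List ℕ} (hstep : ∀ n, R.labelled.StepAt (p n) (a n) (a (n + 1)))
    (hmin : ∀ n q ρ, R.HasLabel (a n) q ρ → (p n).length ≤ q.length) (d : ℕ) :
    ∃ N, ∀ n, N ≤ n → ∀ q ρ, q.length < d → ¬ R.HasLabel (a n) q ρ := by
  induction d with
  | zero => exact ⟨0, by simp⟩
  | succ d ih =>
    obtain ⟨N, hN⟩ := ih
    let A : ℕ → Set (List ℕ) := fun n => {q | q.length = d ∧ ∃ ρ, R.HasLabel (a n) q ρ}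
    have hfin : ∀ n, (A n).Finite := fun n =>
      ((a n).finite_positions_length d).subset fun q ⟨hq, ρ, hρ⟩ => ⟨hρ.mem_positions, hq⟩
    have hlen : ∀ n, N ≤ n → d ≤ (p n).length := by
      intro n hn
      obtain ⟨ρ, hρ⟩ := (hstep n).hasLabel
      by_contra hlt
      exact hN n hn _ ρ (not_le.1 hlt) hρ
    have hsub : ∀ n, N ≤ n → A (n + 1) ⊆ A n := by
      rintro n hn q ⟨hq, hρ⟩
      exact ⟨hq, ((hasLabel_step_iff hc (hstep n) (hq.le.trans (hlen n hn))).1 hρ).1⟩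
    have hex : ∀ (k n : ℕ), N ≤ n → (A n).ncard = k → ∃ m, n ≤ m ∧ A m = ∅ := by
      intro k
      induction k using Nat.strong_induction_on with
      | _ k ihk =>
        intro n hn hk
        by_cases hem : A n = ∅
        · exact ⟨n, le_rfl, hem⟩
        · obtain ⟨q, hq, ρ, hρ⟩ := Set.nonempty_iff_ne_empty.2 hem
          have hpn : p n ∈ A n :=
            ⟨le_antisymm (hq ▸ hmin n q ρ hρ) (hlen n hn), (hstep n).hasLabel⟩
          have hpn' : p n ∉ A (n + 1) := fun h =>
            ((hasLabel_step_iff hc (hstep n) le_rfl).1 h.2).2 rfl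
          have hss : A (n + 1) ⊂ A n := ⟨hsub n hn, fun h => hpn' (h hpn)⟩
          obtain ⟨m, hm, hm'⟩ := ihk _ (hk ▸ Set.ncard_lt_ncard hss (hfin n)) (n + 1)
            (by omega) rfl
          exact ⟨m, by omega, hm'⟩
    obtain ⟨M, hM, hem⟩ := hex _ N le_rfl rfl
    have hem' : ∀ n, M ≤ n → A n = ∅ := by
      intro n hn
      induction n, hn using Nat.le_induction with
      | base => exact hem
      | succ n hn ih => exact Set.subset_empty_iff.1 (ih ▸ hsub n (hM.trans hn))
    refine ⟨M, fun n hn q ρ hq hρ => ?_⟩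
    rcases Nat.lt_succ_iff_lt_or_eq.1 hq with h | h
    · exact hN n (hM.trans hn) q ρ h hρ
    · exact (hem' n hn ▸ (⟨h, ρ, hρ⟩ : q ∈ A n) : q ∈ (∅ : Set (List ℕ)))

/-- A well-labelled term reduces to its development, by always contracting a label of minimal
depth. -/
theorem infRed_dev (hl : R.LeftLinear) (hc : R.NonCollapsing) {s : Term R.labelledSig}
    (hs : R.WellLabelled s) : R.labelled.InfRed s (R.unlabelled (R.dev s)) := by
  have hnext : ∀ s : {s // R.WellLabelled s}, ∃ (p : List ℕ) (t : {t // R.WellLabelled t}),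
      (∃ q ρ, R.HasLabel s.1 q ρ) →
        R.labelled.StepAt p s.1 t.1 ∧ ∀ q ρ, R.HasLabel s.1 q ρ → p.length ≤ q.length := by
    rintro ⟨s, hs⟩
    by_cases h : ∃ q ρ, R.HasLabel s q ρ
    · obtain ⟨p, ⟨ρ, hρ⟩, hmin⟩ := exists_minimalFor_of_wellFoundedLT
        (fun q => ∃ ρ, R.HasLabel s q ρ) List.length h
      obtain ⟨t, ht⟩ := hs.exists_stepAt hl hρ
      exact ⟨p, ⟨t, hs.step ht⟩, fun _ => ⟨ht, fun q ρ' hq =>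
        (le_total p.length q.length).elim id fun h' => hmin ⟨ρ', hq⟩ h'⟩⟩
    · exact ⟨[], ⟨s, hs⟩, fun h' => absurd h' h⟩
  choose P T hPT using hnext
  let a : ℕ → {s // R.WellLabelled s} := fun n => T^[n] ⟨s, hs⟩
  have ha : ∀ n, a (n + 1) = T (a n) := fun n => Function.iterate_succ_apply' _ _ _
  have hdev : ∀ N, (∀ n, n < N → ∃ q ρ, R.HasLabel (a n).1 q ρ) →
      R.dev (a N).1 = R.dev s := by
    intro N
    induction N with
    | zero => exact fun _ => rfl
    | succ N ih =>
      intro h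
      rw [← ih fun n hn => h n (by omega), ha]
      exact (dev_step hl hc (a N).2 (hPT _ (h N (by omega))).1).symm
  by_cases hfin : ∃ N, ¬ ∃ q ρ, R.HasLabel (a N).1 q ρ
  · classical
    have hN := Nat.find_spec hfin
    have hlt : ∀ n, n < Nat.find hfin → ∃ q ρ, R.HasLabel (a n).1 q ρ := fun n hn =>
      not_not.1 (Nat.find_min hfin hn)
    have hred : R.labelled.InfRed (a 0).1 (a (Nat.find hfin)).1 :=
      InfRed.of_fin (a := fun n => (a n).1) (p := fun n => P (a n)) fun n hn => by
        simp only [ha]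
        exact (hPT _ (hlt n hn)).1
    have heq : (a (Nat.find hfin)).1 = R.unlabelled (R.dev s) := by
      rw [← hdev _ hlt]
      exact eq_of_agree fun n => agree_unlabelled_dev fun q ρ _ h => hN ⟨q, ρ, h⟩
    rwa [heq] at hred
  · have hall : ∀ n, ∃ q ρ, R.HasLabel (a n).1 q ρ := fun n => by
      by_contra h
      exact hfin ⟨n, h⟩
    have hstep : ∀ n, R.labelled.StepAt (P (a n)) (a n).1 (a (n + 1)).1 := fun n => by
      rw [ha]
      exact (hPT _ (hall n)).1
    refine InfRed.of_nat (a := fun n => (a n).1) (p := fun n => P (a n)) hstep fun d => ?_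
    obtain ⟨N, hN⟩ := exists_no_label_below (a := fun n => (a n).1) hc hstep
      (fun n => (hPT _ (hall n)).2) d
    refine ⟨N, fun n hn => ⟨?_, ?_⟩⟩
    · rw [← hdev n fun m _ => hall m]
      exact agree_unlabelled_dev (hN n hn)
    · obtain ⟨ρ, hρ⟩ := (hstep n).hasLabel
      by_contra hlt
      exact hN n hn _ ρ (not_le.1 hlt) hρ

/-! ### Redexes and labellings -/

theorem mem_redexes_iff (hl : R.LeftLinear) {t : Term S} {u : R.Redex} :
    u ∈ R.redexes t ↔ u.pos ∈ t.positions ∧ Matches u.rule.1.lhs (t.sub u.pos) := by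
  constructor
  · rintro ⟨hp, σ, h⟩
    refine ⟨hp, ?_⟩
    rw [sub_eq_subterm _ hp, h]
    exact matches_subst _ _
  · rintro ⟨hp, h⟩
    exact ⟨hp, _, by rw [← sub_eq_subterm _ hp]; exact h.eq_subst (hl _ u.rule.2)⟩

theorem Redex.pos_mem_pattern (u : R.Redex) : u.pos ∈ u.pattern := by
  obtain ⟨f, hf, -⟩ := labelledRule_lhs_fn_root u.rule
  exact ⟨[], ⟨f, hf⟩, by simp⟩

theorem Redex.Overlap.symm {u v : R.Redex} (h : u.Overlap v) : v.Overlap u := by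
  rwa [Redex.Overlap, Set.inter_comm]

theorem Redex.overlap_of_pos_mem {u v : R.Redex} (h : v.pos ∈ u.pattern) : u.Overlap v :=
  ⟨v.pos, h, v.pos_mem_pattern⟩

theorem Redex.overlap_of_pos_eq {u v : R.Redex} (h : u.pos = v.pos) : u.Overlap v :=
  Redex.overlap_of_pos_mem (h ▸ u.pos_mem_pattern)

theorem Redex.overlap_self (u : R.Redex) : u.Overlap u := Redex.overlap_of_pos_eq rfl

theorem IsMultiRedex.eq_of_overlap {t : Term S} {U : Set R.Redex} (hU : R.IsMultiRedex t U)
    {u v : R.Redex} (hu : u ∈ U) (hv : v ∈ U) (h : u.Overlap v) : u = v := by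
  by_contra hne
  exact hU.2 u hu v hv hne h

theorem IsMultiRedex.mono {t : Term S} {U V : Set R.Redex} (hU : R.IsMultiRedex t U)
    (h : V ⊆ U) : R.IsMultiRedex t V :=
  ⟨h.trans hU.1, fun u hu v hv => hU.2 u (h hu) v (h hv)⟩

theorem fun_of_mem_redexes (hl : R.LeftLinear) {t : Term S} {u : R.Redex}
    (hu : u ∈ R.redexes t) {q : List ℕ} {f : S.Sym} (hq : u.rule.1.lhs.fn q = some (Sum.inl f)) :
    t.fn (u.pos ++ q) = some (Sum.inl f) := by
  obtain ⟨hp, hm⟩ := (mem_redexes_iff hl).1 hu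
  rw [← sub_fn _ hp, hm q f hq]

theorem labelRedexes_fn_none {t : Term S} {U : Set R.Redex} {p : List ℕ} {f : S.Sym}
    (h : t.fn p = some (Sum.inl f)) (hU : ∀ u ∈ U, u.pos ≠ p) :
    (R.labelRedexes t U).fn p = some (Sum.inl (R.plain f)) :=
  labelWith_fn_none h (dif_neg fun ⟨_, hρ⟩ => hU _ hρ rfl)

theorem labelRedexes_fn_some {t : Term S} {U : Set R.Redex} (hU : R.IsMultiRedex t U)
    {u : R.Redex} (hu : u ∈ U) {f : S.Sym} (h : t.fn u.pos = some (Sum.inl f)) :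
    (R.labelRedexes t U).fn u.pos = some (Sum.inl (R.withLabel f u.rule)) := by
  have h' : ∃ ρ : R.rules, (⟨u.pos, ρ⟩ : R.Redex) ∈ U := ⟨u.rule, hu⟩
  have : h'.choose = u.rule := by
    have := hU.eq_of_overlap h'.choose_spec hu (Redex.overlap_of_pos_eq rfl)
    exact congrArg Redex.rule this
  exact labelWith_fn_some h (by rw [dif_pos h', this])

theorem labelRedexes_fn_var_iff {t : Term S} {U : Set R.Redex} {p : List ℕ} {x : ℕ} :
    (R.labelRedexes t U).fn p = some (Sum.inr x) ↔ t.fn p = some (Sum.inr x) :=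
  R.labelWith_fn_eq_var _ _ _ _

theorem labelRedexes_positions {t : Term S} {U : Set R.Redex} :
    (R.labelRedexes t U).positions = t.positions := by
  ext p; simp [labelRedexes, labelWith, positions]

theorem hasLabel_labelRedexes (hl : R.LeftLinear) {t : Term S} {U : Set R.Redex}
    (hU : R.IsMultiRedex t U) {p : List ℕ} {ρ : R.rules} :
    R.HasLabel (R.labelRedexes t U) p ρ ↔ (⟨p, ρ⟩ : R.Redex) ∈ U := by
  constructor
  · rintro ⟨f, hf⟩
    rcases hp : t.fn p with _ | (g | x)
    · rw [labelRedexes, labelWith_fn_eq_none.2 hp] at hf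
      simp at hf
    · by_cases h : ∀ u ∈ U, u.pos ≠ p
      · rw [labelRedexes_fn_none hp h] at hf
        exact absurd (Sum.inl.inj (Option.some.inj hf)) plain_ne_withLabel
      · push Not at h
        obtain ⟨u, hu, rfl⟩ := h
        rw [labelRedexes_fn_some hU hu hp] at hf
        obtain ⟨-, rfl⟩ := withLabel_inj (Sum.inl.inj (Option.some.inj hf))
        exact hu
    · rw [labelRedexes_fn_var_iff.2 hp] at hf
      simp at hf
  · intro h
    obtain ⟨f, hf, -⟩ := labelledRule_lhs_fn_root ρ
    have := fun_of_mem_redexes hl (hU.1 h) hf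
    rw [List.append_nil] at this
    exact ⟨f, labelRedexes_fn_some hU h this⟩

/-- The pattern of a redex that contains no root of a redex in `U` is unlabelled in `t ^ U`. -/
theorem labelRedexes_fn_pattern (hl : R.LeftLinear) {t : Term S} {U : Set R.Redex}
    {u : R.Redex} (hu : u ∈ R.redexes t) {q : List ℕ} {f : S.Sym}
    (hq : u.rule.1.lhs.fn q = some (Sum.inl f)) (hU : ∀ v ∈ U, v.pos ≠ u.pos ++ q) :
    (R.labelRedexes t U).fn (u.pos ++ q) = some (Sum.inl (R.plain f)) :=
  labelRedexes_fn_none (fun_of_mem_redexes hl hu hq) hU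

theorem wellLabelled_labelRedexes (hl : R.LeftLinear) {t : Term S} {U : Set R.Redex}
    (hU : R.IsMultiRedex t U) : R.WellLabelled (R.labelRedexes t U) := by
  intro p ρ h q g hg
  rw [sub_fn _ h.mem_positions]
  have hu := (hasLabel_labelRedexes hl hU).1 h
  obtain ⟨f, hf, ⟨rfl, rfl⟩ | ⟨hq, rfl⟩⟩ := labelledRule_lhs_fun hg
  · have := fun_of_mem_redexes hl (hU.1 hu) hf
    rw [List.append_nil] at this ⊢
    exact labelRedexes_fn_some hU hu this
  · refine labelRedexes_fn_pattern hl (hU.1 hu) hf fun v hv hpos => hq ?_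
    have := hU.eq_of_overlap hu hv (Redex.overlap_of_pos_mem ⟨q, ⟨f, hf⟩, hpos⟩)
    subst this
    simpa using hpos

/-- Multi-steps are computed by the function `dev`. -/
theorem multiStepOf_iff (hl : R.LeftLinear) (hc : R.NonCollapsing) {U : Set R.Redex}
    {t t' : Term S} :
    R.MultiStepOf U t t' ↔ R.IsMultiRedex t U ∧ R.dev (R.labelRedexes t U) = t' := by
  refine and_congr_right fun hU => ?_
  have hw := wellLabelled_labelRedexes hl hU
  constructor
  · intro h
    rw [← (dev_of_infRed hl hc hw h).2, dev_unlabelled]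
  · rintro rfl
    exact infRed_dev hl hc hw

end ITRS

/-! ### Residuals -/

namespace Term

variable {S S' : Signature.{u}}

theorem Agree.map {φ : S.Sym → S'.Sym} {hφ : ∀ f, S'.arity (φ f) = S.arity f} {n : ℕ}
    {s t : Term S} (h : Agree n s t) : Agree n (s.map φ hφ) (t.map φ hφ) := by
  intro p hp
  simp [Term.map, h p hp]

end Term

namespace ITRS

open Term

variable {S : Signature.{u}} {R : ITRS S}

theorem WellLabelled.isMultiRedex (hl : R.LeftLinear) {s : Term R.labelledSig}
    (hs : R.WellLabelled s) :
    R.IsMultiRedex (R.forget s) {u | R.HasLabel s u.pos u.rule} := by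
  constructor
  · intro u hu
    have hp : u.pos ∈ (R.forget s).positions := by
      rw [forget, map_positions]
      exact HasLabel.mem_positions hu
    refine (mem_redexes_iff hl).2 ⟨hp, fun q f hq => ?_⟩
    rw [sub_fn _ hp, forget]
    have hm := hs _ _ hu
    by_cases h : q = []
    · subst h
      obtain ⟨f', hf', h'⟩ := labelledRule_lhs_fn_root u.rule
      have := hm _ _ h'
      rw [sub_fn _ (HasLabel.mem_positions hu)] at this
      rw [map_fn_fun this, forgetSym_withLabel, ← hf', hq]
    · have := hm _ _ (labelledRule_lhs_fn h hq)
      rw [sub_fn _ (HasLabel.mem_positions hu)] at this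
      rw [map_fn_fun this, forgetSym_plain]
  · have key : ∀ u v : R.Redex, R.HasLabel s u.pos u.rule → R.HasLabel s v.pos v.rule →
        u.Overlap v → u.pos <+: v.pos → u = v := by
      intro u v hu hv huv hpos
      obtain ⟨d, hd⟩ := hpos
      obtain ⟨_, ⟨a, ⟨f, hf⟩, rfl⟩, ⟨b, -, hab⟩⟩ := huv
      by_cases h : d = []
      · subst h
        rw [List.append_nil] at hd
        exact Redex.ext hd (hu.unique (hd ▸ hv))
      · exfalso
        rw [← hd, List.append_assoc, List.append_cancel_left_eq] at hab
        obtain ⟨g, hg⟩ := fun_of_prefix _ hf ⟨b, hab.symm⟩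
        have := hs _ _ hu _ _ (labelledRule_lhs_fn h hg)
        rw [sub_fn _ (HasLabel.mem_positions hu), hd] at this
        exact not_hasLabel_of_fn this _ hv
    intro u hu v hv hne huv
    obtain ⟨p, hpu, hpv⟩ := id huv
    obtain ⟨a, -, rfl⟩ := hpu
    obtain ⟨b, -, hab⟩ := hpv
    rcases List.prefix_or_prefix_of_prefix ⟨a, rfl⟩ ⟨b, hab.symm⟩ with h | h
    · exact hne (key u v hu hv huv h)
    · exact hne (key v u hv hu huv.symm h).symm

theorem WellLabelled.eq_labelRedexes (hl : R.LeftLinear) {s : Term R.labelledSig}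
    (hs : R.WellLabelled s) :
    R.labelRedexes (R.forget s) {u | R.HasLabel s u.pos u.rule} = s := by
  ext p : 2
  rcases h : s.fn p with _ | (g | x)
  · exact labelWith_fn_eq_none.2 (by simp [forget, Term.map, h])
  · rcases R.plain_or_withLabel g with ⟨f, rfl⟩ | ⟨f, ρ, rfl⟩
    · refine labelRedexes_fn_none (by rw [forget, map_fn_fun h, forgetSym_plain]) ?_
      rintro u hu rfl
      exact not_hasLabel_of_fn h _ hu
    · exact labelRedexes_fn_some (hs.isMultiRedex hl) (u := ⟨p, ρ⟩)
        (show R.HasLabel s p ρ from ⟨f, h⟩)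
        (by rw [forget, map_fn_fun h, forgetSym_withLabel])
  · exact labelRedexes_fn_var_iff.2 (by rwa [forget, map_fn_var_iff])

/-- The rule `ρ`, as a rule on labelled terms that does not mention labels. -/
def liftRule (ρ : R.rules) : Rule R.labelledSig where
  lhs := R.unlabelled ρ.1.lhs
  rhs := R.unlabelled ρ.1.rhs
  lhs_finite := by
    rw [IsFinite, unlabelled_positions]
    exact ρ.1.lhs_finite
  lhs_not_var := by
    rintro ⟨x, hx⟩
    exact ρ.1.lhs_not_var ⟨x, R.unlabelled_fn_var_iff.1 hx⟩
  vars_subset := by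
    rw [unlabelled_vars, unlabelled_vars]
    exact ρ.1.vars_subset

theorem liftRule_injective : Function.Injective (liftRule (R := R)) := by
  intro ρ ρ' h
  apply Subtype.ext
  apply Rule.ext
  · exact R.unlabelled_injective (congrArg Rule.lhs h)
  · exact R.unlabelled_injective (congrArg Rule.rhs h)

variable (R) in
/-- The rewrite system on labelled terms with the rules of `R`. The labels of a labelled term are
inert symbols for this system, so its developments contract some redexes and trace the labels
of other ones. -/
def lift : ITRS R.labelledSig where
  rules := Set.range (liftRule (R := R))
  finite := by
    have : Finite R.rules := R.finite
    exact Set.finite_range _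

/-- The rules of `R.lift` correspond to the rules of `R`. -/
noncomputable def liftEquiv : R.rules ≃ R.lift.rules := Equiv.ofInjective _ liftRule_injective

theorem liftEquiv_val (ρ : R.rules) : (liftEquiv ρ).1 = liftRule ρ := rfl

theorem LeftLinear.lift (h : R.LeftLinear) : R.lift.LeftLinear := by
  rintro _ ⟨ρ, rfl⟩ p q x hp hq
  exact h _ ρ.2 p q x (R.unlabelled_fn_var_iff.1 hp) (R.unlabelled_fn_var_iff.1 hq)

theorem NonCollapsing.lift (h : R.NonCollapsing) : R.lift.NonCollapsing := by
  rintro _ ⟨ρ, rfl⟩ ⟨x, hx⟩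
  exact h _ ρ.2 ⟨x, R.unlabelled_fn_var_iff.1 hx⟩

variable {φ : R.lift.labelledSig.Sym → R.labelledSig.Sym}
  {hφ : ∀ g, R.labelledSig.arity (φ g) = R.lift.labelledSig.arity g}

/-- The symbol map `φ` turns the labelled rules of `R.lift` into the labelled rules of `R`. -/
structure RespectsRules (φ : R.lift.labelledSig.Sym → R.labelledSig.Sym) : Prop where
  plain : ∀ f, φ (R.lift.plain (R.plain f)) = R.plain f
  withLabel : ∀ f ρ, φ (R.lift.withLabel (R.plain f) (liftEquiv ρ)) = R.withLabel f ρ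

theorem RespectsRules.map_unlabelled (h : RespectsRules φ) (t : Term S) :
    (R.lift.unlabelled (R.unlabelled t)).map φ hφ = R.unlabelled t := by
  rw [unlabelled_eq_map, unlabelled_eq_map]
  ext p : 2
  rcases ht : t.fn p with _ | (f | x) <;> simp [Term.map, ht, h.plain]

theorem RespectsRules.map_lhs (h : RespectsRules φ) (ρ : R.rules) :
    (R.lift.labelledRule (liftEquiv ρ)).lhs.map φ hφ = (R.labelledRule ρ).lhs := by
  ext p : 2
  rcases hp : ρ.1.lhs.fn p with _ | (f | x)
  · rw [fn_eq_none, fn_eq_none]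
    · rw [labelledRule_lhs_positions]
      simp [positions, hp]
    · rw [map_positions, labelledRule_lhs_positions, liftEquiv_val]
      change p ∉ (R.unlabelled ρ.1.lhs).positions
      rw [unlabelled_positions]
      simp [positions, hp]
  · by_cases hne : p = []
    · subst hne
      rw [labelledRule_lhs_fn_nil hp, map_fn_fun (labelledRule_lhs_fn_nil
        (R.unlabelled_fn_fun hp)), h.withLabel]
    · rw [labelledRule_lhs_fn hne hp, map_fn_fun (labelledRule_lhs_fn hne
        (R.unlabelled_fn_fun hp)), h.plain]
  · rw [map_fn_var_iff.2 (labelledRule_lhs_fn_var.2 (R.unlabelled_fn_var_iff.2 hp)),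
      labelledRule_lhs_fn_var.2 hp]

theorem RespectsRules.step (h : RespectsRules φ) {p : List ℕ} {s t : Term R.lift.labelledSig}
    (hst : R.lift.labelled.StepAt p s t) : R.labelled.StepAt p (s.map φ hφ) (t.map φ hφ) := by
  obtain ⟨hp, ρ', σ, hσ, rfl⟩ := stepAt_labelled_iff.1 hst
  obtain ⟨ρ, rfl⟩ := liftEquiv.surjective ρ'
  have hp' : p ∈ (s.map φ hφ).positions := by rwa [map_positions]
  refine stepAt_labelled_iff.2 ⟨hp', ρ, fun x => (σ x).map φ hφ, ?_, ?_⟩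
  · rw [map_sub hp, hσ, map_subst, h.map_lhs]
  · rw [map_replace _ _ hp hp', map_subst]
    congr 2
    exact h.map_unlabelled _

theorem RespectsRules.infRed (h : RespectsRules φ) (hl : R.LeftLinear) (hc : R.NonCollapsing)
    {s t : Term R.lift.labelledSig} (hs : R.WellLabelled (s.map φ hφ))
    (hst : R.lift.labelled.InfRed s t) :
    R.WellLabelled (t.map φ hφ) ∧ R.dev (t.map φ hφ) = R.dev (s.map φ hφ) := by
  refine hst.invariant
    (P := fun t => R.WellLabelled (t.map φ hφ) ∧ R.dev (t.map φ hφ) = R.dev (s.map φ hφ))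
    ?_ ?_ ⟨hs, rfl⟩
  · rintro p a b hab ⟨ha, had⟩
    exact ⟨ha.step (h.step hab), (dev_step hl hc ha (h.step hab)).symm.trans had⟩
  · intro b hb
    refine ⟨WellLabelled.limit fun n => ?_, eq_of_agree fun n => ?_⟩
    · obtain ⟨a, ha, hab⟩ := hb n
      exact ⟨_, ha.1, hab.map⟩
    · obtain ⟨k, hk⟩ := R.exists_agree_dev n
      obtain ⟨a, ha, hab⟩ := hb k
      rw [← ha.2]
      exact (hk _ _ hab.map).symm

variable (R) in
/-- Merging the two labellings of a labelled term over the labelled signature. -/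
noncomputable def mergeSym : R.lift.labelledSig.Sym → R.labelledSig.Sym :=
  Sum.elim id fun g => R.withLabel (R.forgetSym g.1) (liftEquiv.symm g.2)

variable (R) in
/-- Keeping only the outer one of the two labellings of a labelled term over the labelled
signature. -/
noncomputable def outerSym : R.lift.labelledSig.Sym → R.labelledSig.Sym :=
  Sum.elim (fun g => R.plain (R.forgetSym g))
    fun g => R.withLabel (R.forgetSym g.1) (liftEquiv.symm g.2)

theorem mergeSym_plain (g : R.labelledSig.Sym) : R.mergeSym (R.lift.plain g) = g := rfl

theorem mergeSym_withLabel (g : R.labelledSig.Sym) (ρ : R.rules) :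
    R.mergeSym (R.lift.withLabel g (liftEquiv ρ)) = R.withLabel (R.forgetSym g) ρ := by
  change R.withLabel (R.forgetSym g) (liftEquiv.symm (liftEquiv ρ)) = _
  rw [Equiv.symm_apply_apply]

theorem outerSym_plain (g : R.labelledSig.Sym) :
    R.outerSym (R.lift.plain g) = R.plain (R.forgetSym g) := rfl

theorem outerSym_withLabel (g : R.labelledSig.Sym) (ρ : R.rules) :
    R.outerSym (R.lift.withLabel g (liftEquiv ρ)) = R.withLabel (R.forgetSym g) ρ := by
  change R.withLabel (R.forgetSym g) (liftEquiv.symm (liftEquiv ρ)) = _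
  rw [Equiv.symm_apply_apply]

theorem arity_mergeSym (g : R.lift.labelledSig.Sym) :
    R.labelledSig.arity (R.mergeSym g) = R.lift.labelledSig.arity g := by
  rcases g with g | ⟨g, ρ⟩
  · rfl
  · exact R.arity_forgetSym g

theorem arity_outerSym (g : R.lift.labelledSig.Sym) :
    R.labelledSig.arity (R.outerSym g) = R.lift.labelledSig.arity g := by
  rcases g with g | ⟨g, ρ⟩
  · exact R.arity_forgetSym g
  · exact R.arity_forgetSym g

theorem respectsRules_mergeSym : RespectsRules R.mergeSym where
  plain _ := rfl
  withLabel _ _ := mergeSym_withLabel _ _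

theorem respectsRules_outerSym : RespectsRules R.outerSym where
  plain _ := rfl
  withLabel _ _ := outerSym_withLabel _ _

variable (R) in
/-- A redex of `R` as a redex of `R.lift`. -/
noncomputable def Redex.lift (u : R.Redex) : R.lift.Redex := ⟨u.pos, liftEquiv u.rule⟩

theorem Redex.lift_pattern (u : R.Redex) : (u.lift R).pattern = u.pattern := by
  have : (liftEquiv u.rule).1.lhs.funPositions = u.rule.1.lhs.funPositions := by
    ext p
    change (∃ f, (R.unlabelled u.rule.1.lhs).fn p = _) ↔ ∃ f, _
    constructor
    · rintro ⟨g, hg⟩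
      rcases h : u.rule.1.lhs.fn p with _ | (f | x)
      · rw [unlabelled, labelWith_fn_eq_none.2 h] at hg
        simp at hg
      · exact ⟨f, rfl⟩
      · rw [R.unlabelled_fn_var_iff.2 h] at hg
        simp at hg
    · rintro ⟨f, hf⟩
      exact ⟨_, R.unlabelled_fn_fun hf⟩
  simp only [Redex.pattern, Redex.lift, this]

/-- Redexes that do not overlap `U` are redexes in `t ^ U`. -/
theorem lift_isMultiRedex (hl : R.LeftLinear) {t : Term S} {U V : Set R.Redex}
    (hV : R.IsMultiRedex t V) (h : ∀ v ∈ V, ∀ u ∈ U, ¬ v.Overlap u) :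
    R.lift.IsMultiRedex (R.labelRedexes t U) (Redex.lift R '' V) := by
  constructor
  · rintro _ ⟨v, hv, rfl⟩
    have hp : v.pos ∈ (R.labelRedexes t U).positions := by
      rw [labelRedexes_positions]
      exact (hV.1 hv).choose
    refine (mem_redexes_iff hl.lift).2 ⟨hp, fun q g hq => ?_⟩
    change (R.unlabelled v.rule.1.lhs).fn q = _ at hq
    change ((R.labelRedexes t U).sub v.pos).fn q = _
    rw [sub_fn _ hp]
    rcases h' : v.rule.1.lhs.fn q with _ | (f | x)
    · rw [unlabelled, labelWith_fn_eq_none.2 h'] at hq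
      simp at hq
    · rw [R.unlabelled_fn_fun h'] at hq
      rw [← hq]
      exact labelRedexes_fn_pattern hl (hV.1 hv) h' fun u hu hpos =>
        h v hv u hu (Redex.overlap_of_pos_mem ⟨q, ⟨f, h'⟩, hpos⟩)
    · rw [R.unlabelled_fn_var_iff.2 h'] at hq
      simp at hq
  · rintro _ ⟨v, hv, rfl⟩ _ ⟨w, hw, rfl⟩ hne hvw
    rw [Redex.Overlap, Redex.lift_pattern, Redex.lift_pattern] at hvw
    exact hV.2 v hv w hw (fun h => hne (h ▸ rfl)) hvw

/-- A development of `U` factors through the development of a subset `V` of `U`: the labels of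
the redexes in `U \ V` are traced through the development of `V`, and the labels that result
form a multi-redex, the residual of `U`. -/
theorem exists_residual (hl : R.LeftLinear) (hc : R.NonCollapsing) {t : Term S}
    {U V : Set R.Redex} (hU : R.IsMultiRedex t U) (hVU : V ⊆ U) :
    ∃ W, R.IsMultiRedex (R.dev (R.labelRedexes t V)) W ∧
      R.dev (R.labelRedexes (R.dev (R.labelRedexes t V)) W) = R.dev (R.labelRedexes t U) := by
  have hV := hU.mono hVU
  have hUV := hU.mono (Set.sdiff_subset : U \ V ⊆ U)
  have hV' : R.lift.IsMultiRedex (R.labelRedexes t (U \ V)) (Redex.lift R '' V) :=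
    lift_isMultiRedex hl hV fun v hv u hu =>
      hU.2 v (hVU hv) u hu.1 (fun h => hu.2 (h ▸ hv))
  set z := R.lift.labelRedexes (R.labelRedexes t (U \ V)) (Redex.lift R '' V) with hz
  have hfn : ∀ p f, t.fn p = some (Sum.inl f) →
      (∃ v ∈ V, v.pos = p ∧
        z.fn p = some (Sum.inl (R.lift.withLabel (R.plain f) (liftEquiv v.rule)))) ∨
      (∃ v ∈ U \ V, v.pos = p ∧
        z.fn p = some (Sum.inl (R.lift.plain (R.withLabel f v.rule)))) ∨
      ((∀ u ∈ U, u.pos ≠ p) ∧ z.fn p = some (Sum.inl (R.lift.plain (R.plain f)))) := by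
    intro p f hf
    by_cases h1 : ∃ v ∈ V, v.pos = p
    · obtain ⟨v, hv, rfl⟩ := h1
      refine Or.inl ⟨v, hv, rfl, ?_⟩
      refine labelRedexes_fn_some hV' (u := v.lift R) ⟨v, hv, rfl⟩ ?_
      refine labelRedexes_fn_none hf fun u hu hpos => hu.2 ?_
      rwa [hU.eq_of_overlap hu.1 (hVU hv) (Redex.overlap_of_pos_eq hpos)]
    · have h1' : ∀ u ∈ Redex.lift R '' V, u.pos ≠ p := by
        rintro _ ⟨v, hv, rfl⟩ rfl
        exact h1 ⟨v, hv, rfl⟩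
      refine Or.inr ?_
      by_cases h2 : ∃ v ∈ U \ V, v.pos = p
      · obtain ⟨v, hv, rfl⟩ := h2
        exact Or.inl ⟨v, hv, rfl, labelRedexes_fn_none (labelRedexes_fn_some hUV hv hf) h1'⟩
      · have h3 : ∀ u ∈ U, u.pos ≠ p := by
          intro u hu hpos
          by_cases huV : u ∈ V
          · exact h1 ⟨u, huV, hpos⟩
          · exact h2 ⟨u, ⟨hu, huV⟩, hpos⟩
        exact Or.inr ⟨h3,
          labelRedexes_fn_none (labelRedexes_fn_none hf fun u hu => h3 u hu.1) h1'⟩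
  have hvar : ∀ p x, t.fn p = some (Sum.inr x) → z.fn p = some (Sum.inr x) := fun p x hx =>
    labelRedexes_fn_var_iff.2 (labelRedexes_fn_var_iff.2 hx)
  have hnone : ∀ p, t.fn p = none → z.fn p = none := fun p hp =>
    labelWith_fn_eq_none.2 (labelWith_fn_eq_none.2 hp)
  have hmerge : z.map R.mergeSym arity_mergeSym = R.labelRedexes t U := by
    ext p : 2
    rcases hp : t.fn p with _ | (f | x)
    · rw [labelRedexes, labelWith_fn_eq_none.2 hp]
      simp [Term.map, hnone p hp]
    · rcases hfn p f hp with ⟨v, hv, rfl, h⟩ | ⟨v, hv, rfl, h⟩ | ⟨hv, h⟩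
      · rw [map_fn_fun h, labelRedexes_fn_some hU (hVU hv) hp, mergeSym_withLabel,
          forgetSym_plain]
      · rw [map_fn_fun h, labelRedexes_fn_some hU hv.1 hp, mergeSym_plain]
      · rw [map_fn_fun h, labelRedexes_fn_none hp hv, mergeSym_plain]
    · rw [map_fn_var_iff.2 (hvar p x hp), labelRedexes_fn_var_iff.2 hp]
  have houter : z.map R.outerSym arity_outerSym = R.labelRedexes t V := by
    ext p : 2
    rcases hp : t.fn p with _ | (f | x)
    · rw [labelRedexes, labelWith_fn_eq_none.2 hp]
      simp [Term.map, hnone p hp]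
    · rcases hfn p f hp with ⟨v, hv, rfl, h⟩ | ⟨v, hv, rfl, h⟩ | ⟨hv, h⟩
      · rw [map_fn_fun h, labelRedexes_fn_some hV hv hp, outerSym_withLabel, forgetSym_plain]
      · rw [map_fn_fun h, labelRedexes_fn_none hp, outerSym_plain, forgetSym_withLabel]
        intro u hu hpos
        refine hv.2 ?_
        rwa [← hU.eq_of_overlap (hVU hu) hv.1 (Redex.overlap_of_pos_eq hpos)]
      · rw [map_fn_fun h, labelRedexes_fn_none hp fun u hu => hv u (hVU hu), outerSym_plain,
          forgetSym_plain]
    · rw [map_fn_var_iff.2 (hvar p x hp), labelRedexes_fn_var_iff.2 hp]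
  have hred := infRed_dev hl.lift hc.lift (wellLabelled_labelRedexes hl.lift hV')
  rw [← hz] at hred
  set y := R.lift.dev z
  have hy1 : (R.lift.unlabelled y).map R.mergeSym arity_mergeSym = y := by
    rw [unlabelled_eq_map]
    ext p : 2
    rcases hp : y.fn p with _ | (f | x) <;> simp [Term.map, hp, mergeSym_plain]
  have hy2 : (R.lift.unlabelled y).map R.outerSym arity_outerSym = R.unlabelled (R.forget y) := by
    rw [unlabelled_eq_map, unlabelled_eq_map]
    ext p : 2
    rcases hp : y.fn p with _ | (f | x) <;> simp [Term.map, forget, hp, outerSym_plain]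
  have h1 := respectsRules_mergeSym.infRed (hφ := arity_mergeSym) hl hc
    (hmerge ▸ wellLabelled_labelRedexes hl hU) hred
  have h2 := respectsRules_outerSym.infRed (hφ := arity_outerSym) hl hc
    (houter ▸ wellLabelled_labelRedexes hl hV) hred
  rw [hy1, hmerge] at h1
  rw [hy2, houter, dev_unlabelled] at h2
  rw [← h2.2, ← h1.2]
  exact ⟨_, h1.1.isMultiRedex hl, by rw [h1.1.eq_labelRedexes hl]⟩

end ITRS

/-! ### Overlapping redexes have the same contractum -/

namespace Term

variable {S : Signature.{u}}

open Classical in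
/-- The term obtained from `t` by cutting off everything outside of a prefix closed set `P` of
positions, and putting pairwise distinct variables, with numbers at least `N`,
there. -/
noncomputable def cut (t : Term S) (P : Set (List ℕ))
    (hP : ∀ q i, q ++ [i] ∈ P → q ∈ P) (N : ℕ) : Term S where
  fn q :=
    if q ∈ P then t.fn q
    else if q ∈ t.positions ∧ ∀ r i, q = r ++ [i] → r ∈ P then
      some (Sum.inr (N + Encodable.encode q))
    else none
  root_isSome := by
    by_cases h : [] ∈ P
    · simpa [h] using t.root_isSome
    · simp [h, t.nil_mem_positions]
  child_isSome q i := by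
    by_cases hq : q ∈ P
    · have h1 : q ++ [i] ∈ t.positions ↔ ∃ f, t.fn q = some (Sum.inl f) ∧ i < S.arity f :=
        t.child_isSome q i
      rw [if_pos hq, ← h1]
      by_cases h2 : q ++ [i] ∈ P
      · rw [if_pos h2]
        rfl
      · rw [if_neg h2]
        by_cases h3 : q ++ [i] ∈ t.positions
        · rw [if_pos]
          · simpa using h3
          · refine ⟨h3, fun r j h => ?_⟩
            obtain ⟨rfl, -⟩ := List.append_inj' h rfl
            exact hq
        · rw [if_neg (fun h => h3 h.1)]
          simpa using h3
    · rw [if_neg (fun h => hq (hP q i h)), if_neg (fun h => hq (h.2 q i rfl)), if_neg hq]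
      split_ifs <;> simp

variable {t : Term S} {P : Set (List ℕ)} {hP : ∀ q i, q ++ [i] ∈ P → q ∈ P} {N : ℕ}

theorem cut_fn_of_mem {q : List ℕ} (h : q ∈ P) : (t.cut P hP N).fn q = t.fn q := if_pos h

theorem cut_fn_fun {q : List ℕ} {f : S.Sym} (h : (t.cut P hP N).fn q = some (Sum.inl f)) :
    q ∈ P ∧ t.fn q = some (Sum.inl f) := by
  by_cases hq : q ∈ P
  · exact ⟨hq, by rwa [cut_fn_of_mem hq] at h⟩
  · simp only [cut, if_neg hq] at h
    split_ifs at h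
    simp at h

theorem cut_fn_var (hP' : P ⊆ t.funPositions) {q : List ℕ} {x : ℕ}
    (h : (t.cut P hP N).fn q = some (Sum.inr x)) :
    x = N + Encodable.encode q := by
  by_cases hq : q ∈ P
  · rw [cut_fn_of_mem hq] at h
    obtain ⟨f, hf⟩ := hP' hq
    simp [hf] at h
  · simp only [cut, if_neg hq] at h
    split_ifs at h
    simpa using h.symm

theorem cut_isLinear (hP' : P ⊆ t.funPositions) : (t.cut P hP N).IsLinear := by
  intro p q x hp hq
  have := (cut_fn_var hP' hp).symm.trans (cut_fn_var hP' hq)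
  exact Encodable.encode_injective (Nat.add_left_cancel this)

theorem IsLinear.sub {t : Term S} (h : t.IsLinear) {p : List ℕ} (hp : p ∈ t.positions) :
    (t.sub p).IsLinear := by
  intro q r x hq hr
  rw [sub_fn _ hp] at hq hr
  exact List.append_cancel_left (h _ _ _ hq hr)

theorem IsFinite.exists_vars_lt {t : Term S} (h : t.IsFinite) : ∃ N, ∀ x ∈ t.vars, x < N := by
  have : t.vars.Finite := by
    refine (h.biUnion (t := fun p => {x | t.fn p = some (Sum.inr x)}) fun p _ => ?_).subset ?_
    · rcases hp : t.fn p with _ | (f | y)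
      · simp
      · simp
      · refine (Set.finite_singleton y).subset fun x hx => ?_
        simpa using hx.symm
    · rintro x ⟨p, hp⟩
      exact Set.mem_biUnion (t.mem_positions_of_fn hp) hp
  obtain ⟨N, hN⟩ := this.bddAbove
  exact ⟨N + 1, fun x hx => Nat.lt_succ_of_le (hN hx)⟩

end Term

namespace ITRS

open Term

variable {S : Signature.{u}} {R : ITRS S}

theorem matches_unlabelled_iff {m : Term S} {s : Term R.labelledSig} :
    Matches (R.unlabelled m) s ↔
      ∀ q f, m.fn q = some (Sum.inl f) → s.fn q = some (Sum.inl (R.plain f)) := by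
  constructor
  · exact fun h q f hq => h q _ (R.unlabelled_fn_fun hq)
  · intro h q g hg
    rcases hq : m.fn q with _ | (f | x)
    · rw [unlabelled, labelWith_fn_eq_none.2 hq] at hg
      simp at hg
    · rw [← hg, R.unlabelled_fn_fun hq, h q f hq]
    · rw [R.unlabelled_fn_var_iff.2 hq] at hg
      simp at hg

theorem _root_.Term.IsLinear.unlabelled {m : Term S} (h : m.IsLinear) : (R.unlabelled m).IsLinear :=
  fun p q x hp hq => h p q x (R.unlabelled_fn_var_iff.1 hp) (R.unlabelled_fn_var_iff.1 hq)

theorem unlabelled_replace (t u : Term S) {p : List ℕ} (hp : p ∈ t.positions)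
    (hp' : p ∈ (R.unlabelled t).positions) :
    R.unlabelled (t.replace p hp u) = (R.unlabelled t).replace p hp' (R.unlabelled u) := by
  apply eq_replace
  · intro q
    simp only [unlabelled_eq_map, Term.map, replace_fn_append]
  · intro q hq
    simp only [unlabelled_eq_map, Term.map, replace_fn_of_not _ _ _ hq]

/-- If a labelled term matches `ρ₁` at the root and `ρ₂` at a function symbol position `p` of `ρ₁`,
then both contractions have the same result. This is the triviality of the critical pair, pulled
back along a substitution of labelled terms. The most general common instance is obtained by
cutting off the given term outside of the two patterns. -/
theorem WeaklyOrthogonal.contract_eq (hR : R.WeaklyOrthogonal) (ρ₁ ρ₂ : R.rules)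
    {p : List ℕ} (hp : p ∈ ρ₁.1.lhs.funPositions) {s : Term R.labelledSig}
    (h1 : Matches (R.unlabelled ρ₁.1.lhs) s)
    (h2 : Matches (R.unlabelled ρ₂.1.lhs) (s.sub p)) (hps : p ∈ s.positions) :
    (R.unlabelled ρ₁.1.rhs).subst (matcher (R.unlabelled ρ₁.1.lhs) s) =
      s.replace p hps
        ((R.unlabelled ρ₂.1.rhs).subst (matcher (R.unlabelled ρ₂.1.lhs) (s.sub p))) := by
  classical
  have lin1 := hR.1 _ ρ₁.2
  have lin2 := hR.1 _ ρ₂.2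
  have hpl : p ∈ ρ₁.1.lhs.positions := by
    obtain ⟨f, hf⟩ := hp
    exact mem_positions_of_fn _ hf
  set a := ρ₁.1.lhs.sub p with ha
  set b := ρ₂.1.lhs with hb
  have lina : a.IsLinear := lin1.sub hpl
  set θ₁ := matcher (R.unlabelled ρ₁.1.lhs) s with hθ₁
  set θ₂ := matcher (R.unlabelled b) (s.sub p) with hθ₂
  obtain ⟨N, hN⟩ := ρ₁.1.lhs_finite.exists_vars_lt
  -- the unlabelled term that is to be cut
  set t := R.forget (s.sub p) with ht
  have hsa : ∀ q f, a.fn q = some (Sum.inl f) → (s.sub p).fn q = some (Sum.inl (R.plain f)) := by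
    intro q f hq
    rw [ha, sub_fn _ hpl] at hq
    rw [sub_fn _ hps, matches_unlabelled_iff.1 h1 _ _ hq]
  have hsb := matches_unlabelled_iff.1 h2
  have hta : ∀ q f, a.fn q = some (Sum.inl f) → t.fn q = some (Sum.inl f) := fun q f hq => by
    rw [ht, forget, map_fn_fun (hsa q f hq), forgetSym_plain]
  have htb : ∀ q f, b.fn q = some (Sum.inl f) → t.fn q = some (Sum.inl f) := fun q f hq => by
    rw [ht, forget, map_fn_fun (hsb q f hq), forgetSym_plain]
  have hP : a.funPositions ∪ b.funPositions ⊆ t.funPositions := by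
    rintro q (⟨f, hf⟩ | ⟨f, hf⟩)
    · exact ⟨f, hta q f hf⟩
    · exact ⟨f, htb q f hf⟩
  have hP' : ∀ q i, q ++ [i] ∈ a.funPositions ∪ b.funPositions →
      q ∈ a.funPositions ∪ b.funPositions := by
    rintro q i (⟨f, hf⟩ | ⟨f, hf⟩)
    · exact Or.inl (a.fun_of_prefix hf (List.prefix_append _ _))
    · exact Or.inr (b.fun_of_prefix hf (List.prefix_append _ _))
  set m := t.cut _ hP' N with hm
  have hma : Matches a m := fun q f hq => by
    rw [hm, cut_fn_of_mem (Or.inl ⟨f, hq⟩), hta q f hq]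
  have hmb : Matches b m := fun q f hq => by
    rw [hm, cut_fn_of_mem (Or.inr ⟨f, hq⟩), htb q f hq]
  have hmfun : ∀ q f, m.fn q = some (Sum.inl f) →
      a.fn q = some (Sum.inl f) ∨ b.fn q = some (Sum.inl f) := by
    intro q f hq
    obtain ⟨⟨g, hg⟩ | ⟨g, hg⟩, h⟩ := cut_fn_fun hq
    · left; rw [hg, ← hta q g hg, h]
    · right; rw [hg, ← htb q g hg, h]
  have linm : m.IsLinear := cut_isLinear hP
  let σ : ℕ → Term S := fun x => if x ∈ a.vars then matcher a m x else ofVar x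
  let τ : ℕ → Term S := matcher b m
  have hσ : a.subst σ = m := by
    conv_rhs => rw [hma.eq_subst lina]
    apply subst_congr
    intro x hx
    simp only [σ, if_pos hx]
  have hτ : b.subst τ = m := (hmb.eq_subst lin2).symm
  have hp' : p ∈ (ρ₁.1.lhs.subst σ).positions := subst_positions _ _ hpl
  have hmvars : ∀ x ∈ m.vars, N ≤ x := by
    rintro x ⟨q, hq⟩
    rw [cut_fn_var hP hq]
    exact Nat.le_add_right _ _
  have hcp : IsCriticalPair ρ₁.1 ρ₂.1 ((ρ₁.1.lhs.subst σ).replace p hp' (ρ₂.1.rhs.subst τ))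
      (ρ₁.1.rhs.subst σ) := by
    refine ⟨p, hpl, σ, τ, hp', hp, ?_, ?_, ?_, rfl, rfl⟩
    · rw [← sub_eq_subterm]
      refine ⟨hσ.trans hτ.symm, fun σ' τ' h => ⟨matcher m (a.subst σ'), ?_⟩⟩
      rw [← ha, hσ]
      refine (Matches.eq_subst linm fun q f hq => ?_).symm
      rcases hmfun q f hq with h' | h'
      · exact subst_fn_fun _ _ h'
      · rw [← ha] at h
        rw [h]
        exact subst_fn_fun _ _ h'
    · intro x hx
      rw [← sub_eq_subterm, ← ha] at hx
      simp [σ, if_neg hx, ofVar]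
    · rw [← sub_eq_subterm, ← ha, hσ, Set.disjoint_left]
      rintro x hx ⟨q, -, hq⟩
      exact absurd (hN x ⟨q, hq⟩) (not_lt.2 (hmvars x hx))
  have heq := hR.2 _ ρ₁.2 _ ρ₂.2 _ _ hcp
  -- the substitution that specialises the critical pair to the given term
  let υ : ℕ → Term R.labelledSig := fun x =>
    if N ≤ x then matcher (R.unlabelled m) (s.sub p) x else θ₁ x
  have hυm : (R.unlabelled m).subst υ = s.sub p := by
    have hmm : Matches (R.unlabelled m) (s.sub p) := matches_unlabelled_iff.2 fun q f hq =>
      (hmfun q f hq).elim (hsa q f) (hsb q f)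
    conv_rhs => rw [hmm.eq_subst (IsLinear.unlabelled linm)]
    apply subst_congr
    intro x hx
    rw [unlabelled_vars] at hx
    simp only [υ, if_pos (hmvars x hx)]
  have hυsub : ∀ q ∈ m.positions, (R.unlabelled (m.sub q)).subst υ = (s.sub p).sub q := by
    intro q hq
    have hq' : q ∈ (R.unlabelled m).positions := by rwa [unlabelled_positions]
    rw [← unlabelled_sub R hq, ← sub_subst υ _ hq', hυm]
  have hυ₁ : ∀ x ∈ ρ₁.1.lhs.vars, (R.unlabelled (σ x)).subst υ = θ₁ x := by
    intro x hx
    by_cases hxa : x ∈ a.vars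
    · simp only [σ, if_pos hxa]
      obtain ⟨q, hq⟩ := hxa
      have hq1 := hq
      rw [ha, sub_fn _ hpl] at hq1
      have hq2 := R.unlabelled_fn_var_iff.2 hq1
      rw [matcher_eq lina m hq, hυsub q (hma.positions (mem_positions_of_fn _ hq)), Term.sub_sub,
        hθ₁, matcher_eq (IsLinear.unlabelled lin1) s hq2]
      exact h1.positions (mem_positions_of_fn _ hq2)
    · simp only [σ, if_neg hxa]
      rw [subst_of_root_var (x := x) _ _ (R.unlabelled_fn_var_iff.2 (by simp [ofVar]))]
      simp only [υ, if_neg (not_le.2 (hN x hx))]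
  have hυ₂ : ∀ x ∈ b.vars, (R.unlabelled (τ x)).subst υ = θ₂ x := by
    rintro x ⟨q, hq⟩
    simp only [τ]
    rw [matcher_eq lin2 m hq, hυsub q (hmb.positions (mem_positions_of_fn _ hq)), hθ₂,
      matcher_eq (IsLinear.unlabelled lin2) _ (R.unlabelled_fn_var_iff.2 hq)]
  have hr : ∀ (r : Term S) (κ : ℕ → Term S) (θ : ℕ → Term R.labelledSig),
      (∀ x ∈ r.vars, (R.unlabelled (κ x)).subst υ = θ x) →
      (R.unlabelled (r.subst κ)).subst υ = (R.unlabelled r).subst θ := by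
    intro r κ θ h
    rw [unlabelled_subst, subst_subst]
    apply subst_congr
    rwa [unlabelled_vars]
  have h3 := congrArg (fun t => (R.unlabelled t).subst υ) heq
  have hp2 : p ∈ (R.unlabelled (ρ₁.1.lhs.subst σ)).positions := by rwa [unlabelled_positions]
  rw [unlabelled_replace _ _ hp' hp2, replace_subst _ _ _ hp2 (subst_positions _ _ hp2),
    hr ρ₁.1.rhs σ θ₁ (fun x hx => hυ₁ x (ρ₁.1.vars_subset hx)),
    hr ρ₂.1.rhs τ θ₂ (fun x hx => hυ₂ x (ρ₂.1.vars_subset hx))] at h3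
  rw [← h3]
  have h4 : (R.unlabelled (ρ₁.1.lhs.subst σ)).subst υ = s := by
    rw [hr ρ₁.1.lhs σ θ₁ hυ₁]
    exact (h1.eq_subst (IsLinear.unlabelled lin1)).symm
  congr 1

end ITRS

/-! ### Contracting unlabelled redexes of a labelled term -/

namespace Term

variable {S : Signature.{u}}

theorem replace_append (t v : Term S) {p q : List ℕ} (hp : p ∈ t.positions)
    (hq : q ∈ (t.sub p).positions) (hpq : p ++ q ∈ t.positions) :
    t.replace p hp ((t.sub p).replace q hq v) = t.replace (p ++ q) hpq v := by
  apply eq_replace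
  · intro r
    rw [List.append_assoc, replace_fn_append, replace_fn_append]
  · intro r hr
    by_cases h : p <+: r
    · obtain ⟨r, rfl⟩ := h
      rw [replace_fn_append, replace_fn_of_not, sub_fn _ hp]
      exact fun h => hr ((List.prefix_append_right_inj p).2 h)
    · rw [replace_fn_of_not _ _ _ h]

end Term

namespace ITRS

open Term

variable {S : Signature.{u}} {R : ITRS S}

/-- The labelled term `s` has the redex `u`, with a pattern free of labels. -/
def Occurs (s : Term R.labelledSig) (u : R.Redex) : Prop :=
  u.pos ∈ s.positions ∧ Matches (R.unlabelled u.rule.1.lhs) (s.sub u.pos)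

open Classical in
/-- The result of contracting the redex `u` in the labelled term `s`. -/
noncomputable def contract (s : Term R.labelledSig) (u : R.Redex) : Term R.labelledSig :=
  if h : u.pos ∈ s.positions then
    s.replace u.pos h
      ((R.unlabelled u.rule.1.rhs).subst (matcher (R.unlabelled u.rule.1.lhs) (s.sub u.pos)))
  else s

theorem contract_eq_of_overlap (hR : R.WeaklyOrthogonal) {s : Term R.labelledSig}
    {u v : R.Redex} (hu : Occurs s u) (hv : Occurs s v) (huv : u.Overlap v) :
    contract s u = contract s v := by
  have key : ∀ u v : R.Redex, Occurs s u → Occurs s v → u.Overlap v → u.pos <+: v.pos →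
      contract s u = contract s v := by
    rintro u ⟨vp, vr⟩ hu hv huv ⟨p, hp⟩
    dsimp only at hp
    subst hp
    have hp : p ∈ u.rule.1.lhs.funPositions := by
      obtain ⟨_, ⟨a, ⟨f, hf⟩, rfl⟩, b, -, hab⟩ := huv
      rw [List.append_assoc, List.append_cancel_left_eq] at hab
      exact fun_of_prefix _ hf ⟨b, hab.symm⟩
    have hps : p ∈ (s.sub u.pos).positions := by
      have := hv.1
      simpa [positions, sub_fn _ hu.1] using this
    have h := hR.contract_eq u.rule vr hp hu.2 (by rw [sub_sub _ hv.1]; exact hv.2) hps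
    have hv1 : u.pos ++ p ∈ s.positions := hv.1
    rw [contract, contract, dif_pos hu.1, dif_pos hv.1, h, replace_append _ _ _ _ hv1,
      sub_sub _ hv1]
  obtain ⟨p, ⟨a, -, ha⟩, ⟨b, -, hb⟩⟩ := id huv
  rcases List.prefix_or_prefix_of_prefix ⟨a, ha.symm⟩ ⟨b, hb.symm⟩ with h | h
  · exact key u v hu hv huv h
  · exact (key v u hv hu huv.symm h).symm

theorem labelRedexes_fn_congr {t : Term S} {U V : Set R.Redex} {p : List ℕ}
    (h : ∀ ρ, (⟨p, ρ⟩ : R.Redex) ∈ U ↔ (⟨p, ρ⟩ : R.Redex) ∈ V) :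
    (R.labelRedexes t U).fn p = (R.labelRedexes t V).fn p := by
  classical
  let lab : (R.rules → Prop) → Option R.rules :=
    fun Q => if h : ∃ ρ, Q ρ then some h.choose else none
  have hUV : (fun ρ : R.rules => (⟨p, ρ⟩ : R.Redex) ∈ U) = fun ρ => (⟨p, ρ⟩ : R.Redex) ∈ V :=
    funext fun ρ => propext (h ρ)
  change (t.fn p).map (R.labelSym (lab fun ρ => (⟨p, ρ⟩ : R.Redex) ∈ U)) =
    (t.fn p).map (R.labelSym (lab fun ρ => (⟨p, ρ⟩ : R.Redex) ∈ V))
  rw [hUV]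

theorem agree_labelRedexes {t : Term S} {U V : Set R.Redex} {n : ℕ}
    (h : ∀ u : R.Redex, u.pos.length < n → (u ∈ U ↔ u ∈ V)) :
    Agree n (R.labelRedexes t U) (R.labelRedexes t V) :=
  fun p hp => labelRedexes_fn_congr fun ρ => h ⟨p, ρ⟩ hp

theorem labelRedexes_insert_fn {t : Term S} {W : Set R.Redex} {u : R.Redex} {p : List ℕ}
    (h : p ≠ u.pos) :
    (R.labelRedexes t (insert u W)).fn p = (R.labelRedexes t W).fn p := by
  apply labelRedexes_fn_congr
  intro ρ
  rw [Set.mem_insert_iff, or_iff_right]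
  rintro rfl
  exact h rfl

theorem occurs_labelRedexes (hl : R.LeftLinear) {t : Term S} {W : Set R.Redex} {u : R.Redex}
    (hu : u ∈ R.redexes t) (hW : ∀ w ∈ W, ¬ w.Overlap u) : Occurs (R.labelRedexes t W) u := by
  have hp : u.pos ∈ (R.labelRedexes t W).positions := by
    rw [labelRedexes_positions]
    exact hu.choose
  refine ⟨hp, matches_unlabelled_iff.2 fun q f hq => ?_⟩
  rw [sub_fn _ hp]
  exact labelRedexes_fn_pattern hl hu hq fun w hw hpos =>
    hW w hw (Redex.overlap_of_pos_mem ⟨q, ⟨f, hq⟩, hpos⟩).symm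

theorem IsMultiRedex.insert {t : Term S} {W : Set R.Redex} {u : R.Redex}
    (hWm : R.IsMultiRedex t W) (hu : u ∈ R.redexes t) (hW : ∀ w ∈ W, ¬ w.Overlap u) :
    R.IsMultiRedex t (insert u W) := by
  refine ⟨Set.insert_subset hu hWm.1, ?_⟩
  rintro a (rfl | ha) b (rfl | hb) hne
  · exact absurd rfl hne
  · exact fun h => hW b hb h.symm
  · exact hW a ha
  · exact hWm.2 a ha b hb hne

/-- Labelling one more redex, and developing, is the same as contracting this redex first. -/
theorem dev_labelRedexes_insert (hl : R.LeftLinear) (hc : R.NonCollapsing) {t : Term S}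
    {W : Set R.Redex} {u : R.Redex} (hWm : R.IsMultiRedex t W) (hu : u ∈ R.redexes t)
    (hW : ∀ w ∈ W, ¬ w.Overlap u) :
    R.dev (R.labelRedexes t (insert u W)) = R.dev (contract (R.labelRedexes t W) u) := by
  have hm := hWm.insert hu hW
  have hw := wellLabelled_labelRedexes hl hm
  obtain ⟨hp, hocc⟩ := occurs_labelRedexes hl hu hW
  have hp' : u.pos ∈ (R.labelRedexes t (insert u W)).positions := by
    rwa [labelRedexes_positions, ← labelRedexes_positions (U := W)]
  have hlab : R.HasLabel (R.labelRedexes t (insert u W)) u.pos u.rule :=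
    (hasLabel_labelRedexes hl hm).2 (Set.mem_insert u W)
  have hmatch := hw _ _ hlab
  refine dev_step (p := u.pos) hl hc hw (stepAt_labelled_iff.2 ⟨hp', u.rule,
    matcher (R.unlabelled u.rule.1.lhs) ((R.labelRedexes t W).sub u.pos), ?_, ?_⟩)
  · conv_lhs => rw [hmatch.eq_subst (hl.labelledRule u.rule)]
    apply subst_congr
    rintro x ⟨q, hq⟩
    have hq1 := labelledRule_lhs_fn_var.1 hq
    have hq2 := R.unlabelled_fn_var_iff.2 hq1
    rw [matcher_eq (hl.labelledRule u.rule) _ hq,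
      matcher_eq (IsLinear.unlabelled (hl _ u.rule.2)) _ hq2]
    have hqm := hmatch.positions (mem_positions_of_fn _ hq)
    have hqo := hocc.positions (mem_positions_of_fn _ hq2)
    ext r : 2
    rw [sub_fn _ hqm, sub_fn _ hqo, sub_fn _ hp, sub_fn _ hp', labelRedexes_insert_fn]
    -- the left-hand side is no variable, hence `q` is not the root
    intro h
    have hq0 : q = [] := by
      have h' : q ++ r = [] := by simpa using h
      exact (List.append_eq_nil_iff.1 h').1
    subst hq0
    exact u.rule.1.lhs_not_var ⟨x, hq1⟩
  · rw [contract, dif_pos hp]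
    apply eq_replace
    · intro q
      rw [replace_fn_append]
    · intro q hq
      rw [replace_fn_of_not _ _ _ hq, labelRedexes_insert_fn]
      rintro rfl
      exact hq (List.prefix_refl _)

/-- In a multi-redex, a redex may be exchanged for an overlapping one. -/
theorem dev_exchange (hR : R.WeaklyOrthogonal) (hc : R.NonCollapsing) {t : Term S}
    {W : Set R.Redex} {u v : R.Redex} (hWm : R.IsMultiRedex t W) (hu : u ∈ R.redexes t)
    (hv : v ∈ R.redexes t) (hWu : ∀ w ∈ W, ¬ w.Overlap u) (hWv : ∀ w ∈ W, ¬ w.Overlap v)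
    (huv : u.Overlap v) :
    R.dev (R.labelRedexes t (insert u W)) = R.dev (R.labelRedexes t (insert v W)) := by
  rw [dev_labelRedexes_insert hR.1 hc hWm hu hWu, dev_labelRedexes_insert hR.1 hc hWm hv hWv,
    contract_eq_of_overlap hR (occurs_labelRedexes hR.1 hu hWu)
      (occurs_labelRedexes hR.1 hv hWv) huv]

/-! ### Clusters -/

theorem exists_isCluster {t : Term S} {u : R.Redex} (hu : u ∈ R.redexes t) :
    ∃ c, R.IsCluster t c ∧ u ∈ c :=
  ⟨_, ⟨u, hu, rfl⟩, Relation.ReflTransGen.refl⟩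

theorem IsCluster.subset {t : Term S} {c : Set R.Redex} (hc : R.IsCluster t c) :
    c ⊆ R.redexes t := by
  obtain ⟨u, hu, rfl⟩ := hc
  intro v hv
  rcases Relation.ReflTransGen.cases_tail hv with rfl | ⟨w, -, h⟩
  · exact hu
  · exact h.2.1

theorem IsCluster.mem_of_overlap {t : Term S} {c : Set R.Redex} (hc : R.IsCluster t c)
    {u v : R.Redex} (hu : u ∈ c) (hv : v ∈ R.redexes t) (huv : u.Overlap v) : v ∈ c := by
  have hu' := hc.subset hu
  obtain ⟨w, hw, rfl⟩ := hc
  exact Relation.ReflTransGen.tail hu ⟨hu', hv, huv⟩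

/-- To show that a property holds throughout a cluster, it suffices that it holds for one redex
and is inherited by overlapping ones. -/
theorem IsCluster.induction {t : Term S} {c : Set R.Redex} (hc : R.IsCluster t c)
    {P : R.Redex → Prop} {u : R.Redex} (hu : u ∈ c) (hPu : P u)
    (hP : ∀ a ∈ c, ∀ b ∈ c, a.Overlap b → P a → P b) {v : R.Redex} (hv : v ∈ c) : P v := by
  obtain ⟨w, hw, rfl⟩ := hc
  have key : ∀ v, Relation.ReflTransGen
      (fun a b => a ∈ R.redexes t ∧ b ∈ R.redexes t ∧ a.Overlap b) w v → (P v ↔ P w) := by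
    intro v hv
    induction hv with
    | refl => rfl
    | tail h1 h2 ih =>
      rw [← ih]
      exact ⟨hP _ (h1.tail h2) _ h1 h2.2.2.symm, hP _ h1 _ (h1.tail h2) h2.2.2⟩
  exact (key v hv).2 ((key u hu).1 hPu)

theorem IsCluster.eq_of_mem {t : Term S} {c c' : Set R.Redex} (hc : R.IsCluster t c)
    (hc' : R.IsCluster t c') {u : R.Redex} (hu : u ∈ c) (hu' : u ∈ c') : c = c' := by
  apply Set.Subset.antisymm
  · exact fun v hv => hc.induction hu (P := (· ∈ c')) hu'
      (fun a _ b hb hab ha => hc'.mem_of_overlap ha (hc.subset hb) hab) hv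
  · exact fun v hv => hc'.induction hu' (P := (· ∈ c)) hu
      (fun a _ b hb hab ha => hc.mem_of_overlap ha (hc'.subset hb) hab) hv

/-- No position is below the roots of all redexes of a trivial cluster. -/
theorem TrivialCluster.exists_not_prefix {c : Set R.Redex} (h : TrivialCluster c) (q : List ℕ) :
    ∃ v ∈ c, ¬ v.pos <+: q := by
  by_contra! hall
  rcases h with ⟨u, hu, v, hv, h1, h2⟩ | ⟨-, hinf⟩
  · exact (List.prefix_or_prefix_of_prefix (hall u hu) (hall v hv)).elim h1 h2
  · refine hinf ((List.finite_toSet q.inits).subset ?_)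
    rintro _ ⟨u, hu, rfl⟩
    exact (List.mem_inits _ _).2 (hall u hu)

/-- Redexes of a trivial cluster `c` can be dropped from a multi-redex, starting from the lowest
ones. Without the labels of redexes of `c`, all redexes of `c` have the same contractum; it
differs from the given term only below the roots of all of them, that is, not at all. -/
theorem dev_insert_of_trivialCluster (hR : R.WeaklyOrthogonal) (hnc : R.NonCollapsing)
    {t : Term S} {c W : Set R.Redex} {u : R.Redex} (hc : R.IsCluster t c)
    (htriv : TrivialCluster c) (hu : u ∈ c) (hWm : R.IsMultiRedex t W)
    (hWu : ∀ w ∈ W, ¬ w.Overlap u) (hlow : ∀ w ∈ W, w ∈ c → ¬ u.pos <+: w.pos) :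
    R.dev (R.labelRedexes t (insert u W)) = R.dev (R.labelRedexes t W) := by
  rw [dev_labelRedexes_insert hR.1 hnc hWm (hc.subset hu) hWu]
  set s := R.labelRedexes t (W \ c) with hs
  have hocc : ∀ v ∈ c, Occurs s v := fun v hv =>
    occurs_labelRedexes hR.1 (hc.subset hv) fun w hw hwv =>
      hw.2 (hc.mem_of_overlap hv (hWm.1 hw.1) hwv.symm)
  have hall : ∀ v ∈ c, contract s v = contract s u := fun v hv =>
    hc.induction hu (P := fun v => contract s v = contract s u) rfl
      (fun a ha b hb hab h => by
        rw [← h, contract_eq_of_overlap hR (hocc a ha) (hocc b hb) hab]) hv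
  have hself : contract s u = s := by
    ext q : 2
    obtain ⟨v, hv, hvq⟩ := htriv.exists_not_prefix q
    rw [← hall v hv, contract, dif_pos (hocc v hv).1, replace_fn_of_not _ _ _ hvq]
  have hsu := (hocc u hu).1
  have hWp : u.pos ∈ (R.labelRedexes t W).positions := by
    rwa [labelRedexes_positions, ← labelRedexes_positions (U := W \ c)]
  have hsub : (R.labelRedexes t W).sub u.pos = s.sub u.pos := by
    ext q : 2
    rw [sub_fn _ hWp, sub_fn _ hsu]
    refine labelRedexes_fn_congr fun ρ => ⟨fun h => ⟨h, fun hcm => ?_⟩, fun h => h.1⟩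
    exact hlow _ h hcm (List.prefix_append _ _)
  have hrhs : (R.unlabelled u.rule.1.rhs).subst
      (matcher (R.unlabelled u.rule.1.lhs) (s.sub u.pos)) = s.sub u.pos := by
    ext q : 2
    rw [sub_fn _ hsu]
    conv_rhs => rw [← hself]
    rw [contract, dif_pos hsu, replace_fn_append]
  rw [contract, dif_pos hWp, hsub, hrhs, ← hsub, replace_self]

variable (R) in
/-- The redexes of the trivial clusters of `t`. -/
def trivialRedexes (t : Term S) : Set R.Redex :=
  {u | ∃ c, R.IsCluster t c ∧ TrivialCluster c ∧ u ∈ c}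

/-- A term has finitely many redexes with roots up to a given depth. -/
theorem finite_redexes_length_lt (t : Term S) (n : ℕ) :
    {u | u ∈ R.redexes t ∧ u.pos.length < n}.Finite := by
  have : Finite R.rules := R.finite
  have h := (t.finite_positions_length_lt n).prod (Set.finite_univ (α := R.rules))
  refine (h.image fun x => (⟨x.1, x.2⟩ : R.Redex)).subset ?_
  rintro u ⟨hu, hn⟩
  exact ⟨(u.pos, u.rule), ⟨⟨hu.choose, hn⟩, Set.mem_univ _⟩, rfl⟩

theorem dev_sdiff_trivialRedexes_of_finite (hR : R.WeaklyOrthogonal) (hnc : R.NonCollapsing)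
    {t : Term S} {U : Set R.Redex} (hU : R.IsMultiRedex t U) (hfin : U.Finite) :
    R.dev (R.labelRedexes t U) = R.dev (R.labelRedexes t (U \ R.trivialRedexes t)) := by
  induction hk : U.ncard using Nat.strong_induction_on generalizing U with
  | _ k ih =>
  by_cases hem : (U ∩ R.trivialRedexes t).Nonempty
  · obtain ⟨u, ⟨huU, c, hc, htriv, huc⟩, hmax⟩ :=
      Set.exists_max_image _ (fun u : R.Redex => u.pos.length)
        (hfin.subset Set.inter_subset_left) hem
    have hW := hU.mono (Set.sdiff_subset : U \ {u} ⊆ U)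
    have hWu : ∀ w ∈ U \ {u}, ¬ w.Overlap u := fun w hw => hU.2 w hw.1 u huU hw.2
    have hUW : insert u (U \ {u}) = U := by simp [huU]
    have h := dev_insert_of_trivialCluster hR hnc hc htriv huc hW hWu (by
      intro w hw hwc hpre
      have hle : w.pos.length ≤ u.pos.length := hmax w ⟨hw.1, c, hc, htriv, hwc⟩
      exact hWu w hw (Redex.overlap_of_pos_eq (hpre.eq_of_length_le hle).symm))
    rw [hUW] at h
    rw [h, ih _ (hk ▸ Set.ncard_sdiff_singleton_lt_of_mem huU hfin) hW
      (hfin.subset Set.sdiff_subset) rfl]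
    congr 2
    ext w
    simp only [Set.mem_sdiff, Set.mem_singleton_iff]
    refine ⟨fun hw => ⟨hw.1.1, hw.2⟩, fun hw => ⟨⟨hw.1, ?_⟩, hw.2⟩⟩
    rintro rfl
    exact hw.2 ⟨c, hc, htriv, huc⟩
  · congr 2
    ext w
    exact ⟨fun h => ⟨h, fun h' => hem ⟨w, h, h'⟩⟩, fun h => h.1⟩

/-- The redexes of trivial clusters can be dropped from a multi-redex. -/
theorem dev_sdiff_trivialRedexes (hR : R.WeaklyOrthogonal) (hnc : R.NonCollapsing)
    {t : Term S} {U : Set R.Redex} (hU : R.IsMultiRedex t U) :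
    R.dev (R.labelRedexes t U) = R.dev (R.labelRedexes t (U \ R.trivialRedexes t)) := by
  refine eq_of_agree fun n => ?_
  obtain ⟨k, hk⟩ := R.exists_agree_dev n
  set V := {u | u ∈ U ∧ u.pos.length < k} with hV
  have hVU : V ⊆ U := fun u hu => hu.1
  have hfin : V.Finite :=
    (finite_redexes_length_lt t k).subset fun u hu => ⟨hU.1 hu.1, hu.2⟩
  have h1 : Agree k (R.labelRedexes t U) (R.labelRedexes t V) :=
    agree_labelRedexes fun u hu => ⟨fun h => ⟨h, hu⟩, fun h => h.1⟩
  have h2 : Agree k (R.labelRedexes t (V \ R.trivialRedexes t))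
      (R.labelRedexes t (U \ R.trivialRedexes t)) :=
    agree_labelRedexes fun u hu => ⟨fun h => ⟨h.1.1, h.2⟩, fun h => ⟨⟨h.1, hu⟩, h.2⟩⟩
  refine (hk _ _ h1).trans ?_
  rw [dev_sdiff_trivialRedexes_of_finite hR hnc (hU.mono hVU) hfin]
  exact hk _ _ h2

/-! ### Exchanging overlapping redexes -/

/-- The redexes `φ u` overlap the redexes `u` of `U`, and they are suitable for replacing them one
by one, from top to bottom. -/
structure IsExchange (t : Term S) (U F : Set R.Redex) (φ : R.Redex → R.Redex) : Prop where
  mem : ∀ u ∈ U, φ u ∈ F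
  overlap : ∀ u ∈ U, u.Overlap (φ u)
  not_overlap : ∀ u ∈ U, ∀ v ∈ R.redexes t, ¬ u.Overlap v → ¬ v.pos <+: u.pos →
    ¬ (φ u).Overlap v

theorem IsExchange.dev_eq_of_finite (hR : R.WeaklyOrthogonal) (hnc : R.NonCollapsing)
    {t : Term S} {U F D : Set R.Redex} {φ : R.Redex → R.Redex} (h : IsExchange t U F φ)
    (hU : R.IsMultiRedex t U) (hF : R.IsMultiRedex t F) (hDU : D ⊆ U) (hfin : D.Finite)
    (hD : ∀ u ∈ D, ∀ v ∈ U, v.pos <+: u.pos → v ∈ D) :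
    R.dev (R.labelRedexes t U) = R.dev (R.labelRedexes t ((U \ D) ∪ φ '' D)) := by
  induction hk : D.ncard using Nat.strong_induction_on generalizing D with
  | _ k ih =>
  rcases D.eq_empty_or_nonempty with rfl | hne
  · simp
  obtain ⟨u, hu, hmax⟩ := Set.exists_max_image D (fun u : R.Redex => u.pos.length) hfin hne
  have huU := hDU hu
  -- by maximality of the depth, `u` is not above another redex of `D`
  have hbelow : ∀ v ∈ D \ {u}, ¬ u.pos <+: v.pos := by
    rintro v ⟨hv, hvu⟩ hpre
    exact hU.2 v (hDU hv) u huU hvu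
      (Redex.overlap_of_pos_eq (hpre.eq_of_length_le (hmax v hv)).symm)
  have hφD : ∀ w ∈ U \ D, ∀ v ∈ D, ¬ w.Overlap (φ v) := by
    rintro w ⟨hw, hwD⟩ v hv hwv
    refine h.not_overlap v (hDU hv) w (hU.1 hw) (hU.2 v (hDU hv) w hw ?_)
      (fun hpre => hwD (hD v hv w hw hpre)) hwv.symm
    rintro rfl
    exact hwD hv
  have hφu : ∀ v ∈ D \ {u}, ¬ (φ v).Overlap u := fun v hv =>
    h.not_overlap v (hDU hv.1) u (hU.1 huU) (hU.2 v (hDU hv.1) u huU hv.2) (hbelow v hv)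
  have hW : R.IsMultiRedex t ((U \ D) ∪ φ '' (D \ {u})) := by
    refine ⟨Set.union_subset (Set.sdiff_subset.trans hU.1) ?_, ?_⟩
    · rintro _ ⟨v, hv, rfl⟩
      exact hF.1 (h.mem v (hDU hv.1))
    · rintro a (ha | ⟨a, ha, rfl⟩) b (hb | ⟨b, hb, rfl⟩) hab
      · exact hU.2 a ha.1 b hb.1 hab
      · exact hφD a ha b hb.1
      · exact fun h' => hφD b hb a ha.1 h'.symm
      · exact hF.2 _ (h.mem a (hDU ha.1)) _ (h.mem b (hDU hb.1)) hab
  have hex := dev_exchange hR hnc hW (hU.1 huU) (hF.1 (h.mem u huU)) (by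
      rintro w (hw | ⟨v, hv, rfl⟩)
      · refine hU.2 w hw.1 u huU ?_
        rintro rfl
        exact hw.2 hu
      · exact hφu v hv) (by
      rintro w (hw | ⟨v, hv, rfl⟩)
      · exact hφD w hw u hu
      · intro hov
        have := hF.eq_of_overlap (h.mem v (hDU hv.1)) (h.mem u huU) hov
        exact hφu v hv (this ▸ (h.overlap u huU).symm)) (h.overlap u huU)
  have h1 : insert u ((U \ D) ∪ φ '' (D \ {u})) = (U \ (D \ {u})) ∪ φ '' (D \ {u}) := by
    rw [← Set.insert_union]
    congr 1
    ext w
    simp only [Set.mem_insert_iff, Set.mem_sdiff, Set.mem_singleton_iff]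
    by_cases hwu : w = u
    · simp [hwu, huU]
    · simp [hwu]
  have h2 : insert (φ u) ((U \ D) ∪ φ '' (D \ {u})) = (U \ D) ∪ φ '' D := by
    rw [← Set.union_insert, ← Set.image_insert_eq, Set.insert_sdiff_singleton,
      Set.insert_eq_of_mem hu]
  rw [h1, h2] at hex
  rw [← hex]
  refine ih _ (hk ▸ Set.ncard_sdiff_singleton_lt_of_mem hu hfin) (Set.sdiff_subset.trans hDU)
    (hfin.subset Set.sdiff_subset) ?_ rfl
  refine fun v hv w hw hpre => ⟨hD v hv.1 w hw hpre, ?_⟩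
  rintro rfl
  exact hbelow v hv hpre

/-- Exchanging all redexes of a multi-redex for overlapping ones, from top to bottom, does not
change the development. -/
theorem IsExchange.dev_eq (hR : R.WeaklyOrthogonal) (hnc : R.NonCollapsing)
    {t : Term S} {U F : Set R.Redex} {φ : R.Redex → R.Redex} (h : IsExchange t U F φ)
    (hU : R.IsMultiRedex t U) (hF : R.IsMultiRedex t F) :
    R.dev (R.labelRedexes t U) = R.dev (R.labelRedexes t (φ '' U)) := by
  refine eq_of_agree fun n => ?_
  obtain ⟨k, hk⟩ := R.exists_agree_dev n
  obtain ⟨d, hd⟩ := R.exists_depth_bound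
  -- overlapping redexes have roots whose depths differ by at most `d`
  have hφ : ∀ u ∈ U, u.pos.length ≤ (φ u).pos.length + d := by
    intro u hu
    obtain ⟨_, ⟨a, -, rfl⟩, b, ⟨f, hf⟩, hab⟩ := h.overlap u hu
    have h1 := congrArg List.length hab
    have h2 := hd _ (φ u).rule.2 b (mem_positions_of_fn _ hf)
    simp only [List.length_append] at h1
    omega
  rw [h.dev_eq_of_finite hR hnc hU hF (D := {u | u ∈ U ∧ u.pos.length < k + d})
    (fun u hu => hu.1)
    ((finite_redexes_length_lt t (k + d)).subset fun u hu => ⟨hU.1 hu.1, hu.2⟩)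
    (fun u hu v hv hpre => ⟨hv, hpre.length_le.trans_lt hu.2⟩)]
  refine hk _ _ (agree_labelRedexes fun v hv => ⟨?_, ?_⟩)
  · rintro (⟨h1, h2⟩ | ⟨u, hu, rfl⟩)
    · exact absurd ⟨h1, by omega⟩ h2
    · exact ⟨u, hu.1, rfl⟩
  · rintro ⟨u, hu, rfl⟩
    exact Or.inr ⟨u, ⟨hu, by have := hφ u hu; omega⟩, rfl⟩

end ITRS

/-! ### Full multi-redexes -/

namespace ITRS

open Term

variable {S : Signature.{u}} {R : ITRS S}

theorem Redex.pos_prefix_of_mem_pattern {u : R.Redex} {p : List ℕ} (h : p ∈ u.pattern) :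
    u.pos <+: p := by
  obtain ⟨q, -, rfl⟩ := h
  exact List.prefix_append _ _

theorem Redex.mem_pattern_of_between {u : R.Redex} {p q : List ℕ} (hp : p ∈ u.pattern)
    (h1 : u.pos <+: q) (h2 : q <+: p) : q ∈ u.pattern := by
  obtain ⟨a, ⟨f, hf⟩, rfl⟩ := hp
  obtain ⟨b, rfl⟩ := h1
  exact ⟨b, fun_of_prefix _ hf ((List.prefix_append_right_inj _).1 h2), rfl⟩

/-- If two redexes overlap and the root of one is above the root of the other, then the latter root
is in the pattern of the former redex. -/
theorem Redex.Overlap.pos_mem {u v : R.Redex} (h : u.Overlap v) (hpos : u.pos <+: v.pos) :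
    v.pos ∈ u.pattern := by
  obtain ⟨p, hpu, hpv⟩ := h
  exact Redex.mem_pattern_of_between hpu hpos (Redex.pos_prefix_of_mem_pattern hpv)

theorem Redex.pattern_finite (u : R.Redex) : u.pattern.Finite := by
  refine (u.rule.1.lhs_finite.image (u.pos ++ ·)).subset ?_
  rintro _ ⟨q, ⟨f, hf⟩, rfl⟩
  exact ⟨q, mem_positions_of_fn _ hf, rfl⟩

theorem ICluster.comparable {c : Set R.Redex} (h : ICluster c) {u v : R.Redex} (hu : u ∈ c)
    (hv : v ∈ c) : u.pos <+: v.pos ∨ v.pos <+: u.pos := by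
  by_contra! hn
  exact h ⟨u, hu, v, hv, hn.1, hn.2⟩

theorem pos_mem_rootPath {c : Set R.Redex} {u : R.Redex} (hu : u ∈ c) : u.pos ∈ rootPath c :=
  ⟨u, hu, u, hu, List.prefix_refl _, List.prefix_refl _⟩

theorem ICluster.rootPath_comparable {c : Set R.Redex} (h : ICluster c) {p q : List ℕ}
    (hp : p ∈ rootPath c) (hq : q ∈ rootPath c) : p <+: q ∨ q <+: p := by
  obtain ⟨-, -, v, hv, -, hpv⟩ := hp
  obtain ⟨-, -, w, hw, -, hqw⟩ := hq
  rcases h.comparable hv hw with hvw | hwv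
  · exact List.prefix_or_prefix_of_prefix (hpv.trans hvw) hqw
  · exact List.prefix_or_prefix_of_prefix hpv (hqw.trans hwv)

theorem ICluster.exists_isTail {c : Set R.Redex} (h : ICluster c) {u : R.Redex} (hu : u ∈ c) :
    ∃ p, IsTail c u p := by
  obtain ⟨p, hp, hmax⟩ := Set.exists_max_image (u.pattern ∩ rootPath c) List.length
    (u.pattern_finite.subset Set.inter_subset_left) ⟨u.pos, u.pos_mem_pattern, pos_mem_rootPath hu⟩
  refine ⟨p, hp, fun q hq => ?_⟩
  rcases h.rootPath_comparable hp.2 hq.2 with hpq | hqp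
  · rw [hpq.eq_of_length_le (hmax q hq)]
  · exact hqp

theorem Redex.not_below_self (u : R.Redex) : ¬ u.Below u := fun h => h.2 u.overlap_self

theorem Selection.subset {c : Set R.Redex} {l : List R.Redex} (h : Selection c l) :
    ∀ u ∈ l, u ∈ c := by
  induction h with
  | nil => simp
  | select l u p _ hu _ _ ih =>
    intro v hv
    rcases List.mem_cons.1 hv with rfl | hv
    · exact hu.1
    · exact ih v hv

theorem Selection.not_overlap {c : Set R.Redex} {l : List R.Redex} (h : Selection c l) :
    ∀ u ∈ l, ∀ v ∈ l, u ≠ v → ¬ u.Overlap v := by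
  induction h with
  | nil => simp
  | select l u p _ hu _ _ ih =>
    intro v hv w hw hne
    rcases List.mem_cons.1 hv with rfl | hv' <;> rcases List.mem_cons.1 hw with rfl | hw'
    · exact absurd rfl hne
    · exact fun h => (hu.2 w hw').2 h.symm
    · exact (hu.2 v hv').2
    · exact ih v hv' w hw' hne

theorem ICluster.exists_selection {c : Set R.Redex} (hI : ICluster c) (hfin : c.Finite) :
    ∃ l, Selection c l ∧ selectable c l = ∅ := by
  have hfs : ∀ l, (selectable c l).Finite := fun l => hfin.subset fun u hu => hu.1
  have key : ∀ (k : ℕ) (l : List R.Redex), Selection c l → (selectable c l).ncard = k →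
      ∃ l, Selection c l ∧ selectable c l = ∅ := by
    intro k
    induction k using Nat.strong_induction_on with
    | _ k ih =>
    intro l hl hk
    rcases (selectable c l).eq_empty_or_nonempty with hem | ⟨v, hv⟩
    · exact ⟨l, hl, hem⟩
    obtain ⟨p, ⟨u, hu, hup⟩, hmin⟩ := exists_minimalFor_of_wellFoundedLT
      (fun p => ∃ u ∈ selectable c l, IsTail c u p) List.length
      (by obtain ⟨p, hp⟩ := hI.exists_isTail hv.1; exact ⟨p, v, hv, hp⟩)
    have hsel : Selection c (u :: l) := by
      refine Selection.select l u p hl hu hup fun w hw q hq => ?_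
      rcases hI.rootPath_comparable hup.1.2 hq.1.2 with h | h
      · exact h
      · rw [h.eq_of_length_le (hmin ⟨w, hw, hq⟩ h.length_le)]
    refine ih _ ?_ (u :: l) hsel rfl
    rw [← hk]
    refine Set.ncard_lt_ncard ⟨fun w hw => ⟨hw.1, fun x hx => hw.2 x (List.mem_cons_of_mem u hx)⟩,
      fun h => ?_⟩ (hfs l)
    exact u.not_below_self ((h hu).2 u List.mem_cons_self)
  exact key _ [] Selection.nil rfl

theorem finite_of_not_trivialCluster {c : Set R.Redex} (h : ¬ TrivialCluster c) :
    ICluster c ∧ c.Finite := by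
  rw [TrivialCluster, not_or, not_and] at h
  have hI : ICluster c := h.1
  have hpos : (Redex.pos '' c).Finite := Set.not_infinite.1 (h.2 hI)
  refine ⟨hI, ?_⟩
  have : Finite R.rules := R.finite
  refine ((hpos.prod (Set.finite_univ (α := R.rules))).image
    fun x => (⟨x.1, x.2⟩ : R.Redex)).subset ?_
  exact fun u hu => ⟨(u.pos, u.rule), ⟨⟨u, hu, rfl⟩, Set.mem_univ _⟩, rfl⟩

theorem exists_isFullOfCluster (c : Set R.Redex) : ∃ F, IsFullOfCluster c F := by
  by_cases h : TrivialCluster c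
  · exact ⟨∅, Or.inl ⟨h, rfl⟩⟩
  · obtain ⟨hI, hfin⟩ := finite_of_not_trivialCluster h
    obtain ⟨l, hl, hem⟩ := hI.exists_selection hfin
    exact ⟨_, Or.inr ⟨h, l, hl, hem, rfl⟩⟩

theorem exists_isFull (t : Term S) : ∃ F, R.IsFull t F := by
  choose full hfull using fun c : Set R.Redex => exists_isFullOfCluster c
  exact ⟨_, full, fun c _ => hfull c, rfl⟩

theorem IsFullOfCluster.subset {c F : Set R.Redex} (h : IsFullOfCluster c F) : F ⊆ c := by
  rcases h with ⟨-, rfl⟩ | ⟨-, l, hl, -, rfl⟩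
  · exact Set.empty_subset _
  · exact hl.subset

theorem IsFull.isMultiRedex {t : Term S} {F : Set R.Redex} (h : R.IsFull t F) :
    R.IsMultiRedex t F := by
  obtain ⟨full, hfull, rfl⟩ := h
  constructor
  · rintro u ⟨c, hc, hu⟩
    exact hc.subset ((hfull c hc).subset hu)
  · rintro u ⟨c, hc, hu⟩ v ⟨c', hc', hv⟩ hne huv
    have huc := (hfull c hc).subset hu
    have hvc := (hfull c' hc').subset hv
    obtain rfl := hc.eq_of_mem hc' (hc.mem_of_overlap huc (hc'.subset hvc) huv) hvc
    rcases hfull c hc with ⟨-, h⟩ | ⟨-, l, hl, -, h⟩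
    · rw [h] at hu
      exact hu
    · rw [h] at hu hv
      exact hl.not_overlap u hu v hv hne huv

/-- During the selection, a redex remains selectable until the first selected redex that overlaps
it, and the tail of that one is not below its tail. -/
theorem Selection.selectable_or_overlap {c : Set R.Redex} (hI : ICluster c) {l : List R.Redex}
    (hl : Selection c l) {v : R.Redex} (hv : v ∈ c) {q : List ℕ} (hq : IsTail c v q) :
    v ∈ selectable c l ∨ ∃ u ∈ l, v.Overlap u ∧ ∃ p, IsTail c u p ∧ p <+: q := by
  induction hl with
  | nil => exact Or.inl ⟨hv, by simp⟩
  | select l u p _ hu hp hmin ih =>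
    rcases ih with hsel | ⟨w, hw, h⟩
    · have hpq := hmin v hsel q hq
      by_cases huv : u.Overlap v
      · exact Or.inr ⟨u, List.mem_cons_self, huv.symm, p, hp, hpq⟩
      · refine Or.inl ⟨hv, fun w hw => ?_⟩
        rcases List.mem_cons.1 hw with rfl | hw
        · refine ⟨(hI.comparable hu.1 hv).resolve_right fun hvw => huv ?_, huv⟩
          refine (Redex.overlap_of_pos_mem (Redex.mem_pattern_of_between hq.1.1 hvw ?_)).symm
          exact (Redex.pos_prefix_of_mem_pattern hp.1.1).trans hpq
        · exact hsel.2 w hw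
    · exact Or.inr ⟨w, List.mem_cons_of_mem u hw, h⟩

/-- Every redex of a cluster that is not trivial overlaps a redex of a given full multi-redex
whose tail is not below its tail. Hence the latter does not overlap redexes further down. -/
theorem IsFullOfCluster.exists_exchange {t : Term S} {c F : Set R.Redex} (hc : R.IsCluster t c)
    (hF : IsFullOfCluster c F) (hnt : ¬ TrivialCluster c) {u : R.Redex} (hu : u ∈ c) :
    ∃ f ∈ F, u.Overlap f ∧
      ∀ v ∈ R.redexes t, ¬ u.Overlap v → ¬ v.pos <+: u.pos → ¬ f.Overlap v := by
  rcases hF with ⟨ht, -⟩ | ⟨-, l, hl, hem, rfl⟩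
  · exact absurd ht hnt
  have hI := (finite_of_not_trivialCluster hnt).1
  obtain ⟨q, hq⟩ := hI.exists_isTail hu
  rcases hl.selectable_or_overlap hI hu hq with h | ⟨f, hf, huf, p, hp, hpq⟩
  · rw [hem] at h
    exact absurd h (Set.notMem_empty _)
  refine ⟨f, hf, huf, fun v hv huv hvu hfv => ?_⟩
  have hfc := hl.subset f hf
  have hvc := hc.mem_of_overlap hfc hv hfv
  have huvpos := (hI.comparable hu hvc).resolve_right hvu
  -- the root of `v` is between the root and the tail of `u`
  have hvq : v.pos <+: q := by
    rcases hI.comparable hfc hvc with h | h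
    · exact (hp.2 _ ⟨hfv.pos_mem h, pos_mem_rootPath hvc⟩).trans hpq
    · exact (h.trans (Redex.pos_prefix_of_mem_pattern hp.1.1)).trans hpq
  exact huv (Redex.overlap_of_pos_mem (Redex.mem_pattern_of_between hq.1.1 huvpos hvq))

/-- Every multi-redex has the same development as a subset of any given full multi-redex. -/
theorem IsFull.exists_subset_dev_eq (hR : R.WeaklyOrthogonal) (hnc : R.NonCollapsing)
    {t : Term S} {F U : Set R.Redex} (hF : R.IsFull t F) (hU : R.IsMultiRedex t U) :
    ∃ V ⊆ F, R.dev (R.labelRedexes t U) = R.dev (R.labelRedexes t V) := by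
  have hFm := hF.isMultiRedex
  have hU' := hU.mono (Set.sdiff_subset : U \ R.trivialRedexes t ⊆ U)
  have hex : ∀ u, ∃ f, u ∈ U \ R.trivialRedexes t → f ∈ F ∧ u.Overlap f ∧
      ∀ v ∈ R.redexes t, ¬ u.Overlap v → ¬ v.pos <+: u.pos → ¬ f.Overlap v := by
    intro u
    by_cases hu : u ∈ U \ R.trivialRedexes t
    · obtain ⟨c, hc, huc⟩ := exists_isCluster (hU.1 hu.1)
      obtain ⟨full, hfull, rfl⟩ := hF
      obtain ⟨f, hf, h⟩ := (hfull c hc).exists_exchange hc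
        (fun ht => hu.2 ⟨c, hc, ht, huc⟩) huc
      exact ⟨f, fun _ => ⟨⟨c, hc, hf⟩, h⟩⟩
    · exact ⟨u, fun h => absurd h hu⟩
  choose φ hφ using hex
  have hφ' : IsExchange t (U \ R.trivialRedexes t) F φ :=
    ⟨fun u hu => (hφ u hu).1, fun u hu => (hφ u hu).2.1, fun u hu => (hφ u hu).2.2⟩
  refine ⟨φ '' (U \ R.trivialRedexes t), ?_, ?_⟩
  · rintro _ ⟨u, hu, rfl⟩
    exact hφ'.mem u hu
  · rw [dev_sdiff_trivialRedexes hR hnc hU, hφ'.dev_eq hR hnc hU' hFm]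

theorem IsFullDevelopment.isTriangleWitness (hR : R.WeaklyOrthogonal) (hnc : R.NonCollapsing)
    {bullet : Term S → Term S} (h : R.IsFullDevelopment bullet) :
    IsTriangleWitness R.MultiStep bullet := by
  refine ⟨fun t => ?_, fun t b htb => ?_⟩
  · obtain ⟨F, -, hF⟩ := h t
    exact ⟨F, hF⟩
  · obtain ⟨F, hF, htF⟩ := h t
    obtain ⟨U, hU⟩ := htb
    obtain ⟨hFm, hFd⟩ := (multiStepOf_iff hR.1 hnc).1 htF
    obtain ⟨hUm, hUd⟩ := (multiStepOf_iff hR.1 hnc).1 hU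
    obtain ⟨V, hVF, hV⟩ := hF.exists_subset_dev_eq hR hnc hUm
    obtain ⟨W, hW, hWd⟩ := exists_residual hR.1 hnc hFm hVF
    rw [← hV, hUd] at hW hWd
    exact ⟨W, (multiStepOf_iff hR.1 hnc).2 ⟨hW, by rw [hWd, hFd]⟩⟩

end ITRS

theorem mainTheorem4 {S : Signature.{u}} (R : ITRS S)
    (hwo : R.WeaklyOrthogonal) (hnc : R.NonCollapsing) :
    TriangleProperty R.MultiStep ∧
    (∀ t : Term S, ∃ F, R.IsFull t F) ∧
    (∀ (t : Term S) (F : Set R.Redex), R.IsFull t F → ∃ s, R.MultiStepOf F t s) ∧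
    (∀ bullet : Term S → Term S,
      R.IsFullDevelopment bullet → IsTriangleWitness R.MultiStep bullet) := by
  have hdev : ∀ (t : Term S) (F : Set R.Redex), R.IsFull t F → ∃ s, R.MultiStepOf F t s :=
    fun t F hF => ⟨_, (ITRS.multiStepOf_iff hwo.1 hnc).2 ⟨hF.isMultiRedex, rfl⟩⟩
  have hfull : ∃ bullet, R.IsFullDevelopment bullet := by
    choose F hF using ITRS.exists_isFull (R := R)
    choose bullet hb using fun t => hdev t (F t) (hF t)
    exact ⟨bullet, fun t => ⟨F t, hF t, hb t⟩⟩
  obtain ⟨bullet, hb⟩ := hfull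
  exact ⟨⟨bullet, hb.isTriangleWitness hwo hnc⟩, ITRS.exists_isFull, hdev,
    fun bullet hb => hb.isTriangleWitness hwo hnc⟩
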